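/- Links are unoriented tame links in $\mathbb{R}^3$, considered up to ambient isotopy and represented by plane diagrams up to Reidemeister moves. For $n\ge 1$, an $n$-move (respectively a $(-n)$-move) on a link replaces two parallel strands inside a disk of a diagram by $n$ right-handed (respectively left-handed) half twists of these strands, and leaves the link unchanged outside the disk. Two links are $n$-move equivalent if one can be obtained from the other by finitely many $n$-moves, $(-n)$-moves and isotopies. A link is a closed 3-braid if it is isotopic to the standard closure of a braid on three strands, that is, of a word in the generators $\sigma_1,\sigma_2$ and their inverses. **Theorem 1.14.** (i) Every knot which is a closed 3-braid is 4-move equivalent to the trivial knot. (ii) Every link of two components which is a closed 3-braid is 4-move equivalent to the trivial link of two components or to the Hopf link. (iii) Every link of three components which is a closed 3-braid is 4-move equivalent to the trivial link of three components, or to the split union of the Hopf link and a trivial knot, or to the connected sum of two Hopf links, or to the $(3,3)$-torus link (the closure of $(\sigma_1\sigma_2)^3$), or to the Borromean rings (the closure of $(\sigma_1\sigma_2^{-1})^3$). -/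

import Mathlib

/-!
# Link diagrams, Reidemeister moves and n-moves

A link in 3-space is given by a plane diagram. A plane diagram in general position with respect to
the height function is cut by horizontal lines into slices, each containing exactly one local
minimum, one local maximum or one crossing, next to vertical strands. It is therefore a finite word
of slices, listed from the bottom to the top. Two such words are diagrams of the same (unoriented)
link, up to ambient isotopy of 3-space, exactly when they are related by the planar isotopies and
the three Reidemeister moves listed below.
-/

namespace LinkDiagram

/-- What happens in a slice, besides vertical strands. -/
inductive Kind where
  /-- a local minimum, where two new strands begin -/
  | cup
  /-- a local maximum, where two neighbouring strands end -/
  | cap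
  /-- a crossing of two neighbouring strands; `cross true` is a positive generator `σ` (the strand
  going from the lower left to the upper right is the overpass) and `cross false` is its inverse -/
  | cross (s : Bool)

/-- The number of strands that enter the active part of a slice from below. -/
def Kind.bot : Kind → ℕ
  | .cup => 0
  | .cap => 2
  | .cross _ => 2

/-- The number of strands that leave the active part of a slice at the top. -/
def Kind.top : Kind → ℕ
  | .cup => 2
  | .cap => 0
  | .cross _ => 2

/-- A slice: its kind and the number of vertical strands to the left of its active part. The
number of strands to the right is determined by the total number of strands. -/
structure Slice where
  kind : Kind
  pos : ℕ

def cup (i : ℕ) : Slice := ⟨.cup, i⟩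
def cap (i : ℕ) : Slice := ⟨.cap, i⟩

/-- A crossing of the strands number `i` and `i + 1` (strands are counted from `0`, from the left).
-/
def cross (s : Bool) (i : ℕ) : Slice := ⟨.cross s, i⟩

/-- The number of strands above the slice, if there are `n` strands below it. -/
def Slice.next (x : Slice) (n : ℕ) : ℕ := n - x.kind.bot + x.kind.top

/-- `IsTangle n w m`: the slices of `w` can be stacked, in this order from bottom to top, on `n`
strands, and leave `m` strands at the top. -/
def IsTangle : ℕ → List Slice → ℕ → Prop
  | n, [], m => n = m
  | n, x :: w, m => x.pos + x.kind.bot ≤ n ∧ IsTangle (x.next n) w m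

instance instDecidableIsTangle : (n : ℕ) → (w : List Slice) → (m : ℕ) → Decidable (IsTangle n w m)
  | n, [], m => inferInstanceAs (Decidable (n = m))
  | n, x :: w, m =>
    have := instDecidableIsTangle (x.next n) w m
    inferInstanceAs (Decidable (x.pos + x.kind.bot ≤ n ∧ IsTangle (x.next n) w m))

theorem IsTangle.append {a b c : ℕ} {u v : List Slice} (hu : IsTangle a u b)
    (hv : IsTangle b v c) : IsTangle a (u ++ v) c := by
  induction u generalizing a with
  | nil => cases hu; exact hv
  | cons x u ih => exact ⟨hu.1, ih hu.2⟩

end LinkDiagram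

/-- A link diagram: a word of slices that begins and ends with no strands. -/
def LinkDiagram : Type := {w : List LinkDiagram.Slice // LinkDiagram.IsTangle 0 w 0}

namespace LinkDiagram

/-! ### Components -/

/-- The number of strands at the horizontal line above the first `k` slices. -/
def widthAt (w : List Slice) (k : ℕ) : ℕ := (w.take k).foldl (fun n x => x.next n) 0

/-- The points where the link meets the horizontal lines between slices: `(k, j)` is the point
number `j`, from the left, on the line above the first `k` slices. -/
def Point (w : List Slice) : Type := {p : ℕ × ℕ // p.1 ≤ w.length ∧ p.2 < widthAt w p.1}

/-- Two points are joined by an arc of the diagram inside a single slice. -/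
inductive Joined (w : List Slice) : ℕ × ℕ → ℕ × ℕ → Prop
  | left (k : ℕ) (x : Slice) (j : ℕ) : w[k]? = some x → j < x.pos → Joined w (k, j) (k + 1, j)
  | right (k : ℕ) (x : Slice) (j : ℕ) : w[k]? = some x →
      Joined w (k, x.pos + x.kind.bot + j) (k + 1, x.pos + x.kind.top + j)
  | cup (k i : ℕ) : w[k]? = some (cup i) → Joined w (k + 1, i) (k + 1, i + 1)
  | cap (k i : ℕ) : w[k]? = some (cap i) → Joined w (k, i) (k, i + 1)
  | crossLeft (k i : ℕ) (s : Bool) : w[k]? = some (cross s i) → Joined w (k, i) (k + 1, i + 1)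
  | crossRight (k i : ℕ) (s : Bool) : w[k]? = some (cross s i) → Joined w (k, i + 1) (k + 1, i)

/-- The number of components of a link: the number of classes of points for the equivalence
relation generated by being joined by an arc. -/
noncomputable def numComponents (L : LinkDiagram) : ℕ :=
  Nat.card (Quot fun p q : Point L.1 => Joined L.1 p.1 q.1)

/-! ### Moves -/

/-- The local form of the moves between diagrams of the same link: planar isotopies (`commute`,
`zigzag`, `slide`) and Reidemeister moves. The other variants of the Reidemeister moves are
compositions of these. -/
inductive ReidemeisterMove : List Slice → List Slice → Prop
  /-- two slices whose active parts lie side by side may exchange their heights -/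
  | commute (x y : Kind) (i k : ℕ) :
      ReidemeisterMove [⟨x, i⟩, ⟨y, i + x.top + k⟩] [⟨y, i + x.bot + k⟩, ⟨x, i⟩]
  /-- a local minimum followed by a local maximum on the same strand may be straightened -/
  | zigzagLeft (i : ℕ) : ReidemeisterMove [cup i, cap (i + 1)] []
  | zigzagRight (i : ℕ) : ReidemeisterMove [cup (i + 1), cap i] []
  /-- a strand that crosses a minimum (maximum) on one side of it may be moved to the other side -/
  | slideCup (s : Bool) (i : ℕ) :
      ReidemeisterMove [cup i, cross s (i + 1)] [cup (i + 1), cross (!s) i]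
  | slideCap (s : Bool) (i : ℕ) :
      ReidemeisterMove [cross s (i + 1), cap i] [cross (!s) i, cap (i + 1)]
  /-- first Reidemeister move -/
  | r1Cup (s : Bool) (i : ℕ) : ReidemeisterMove [cup i, cross s i] [cup i]
  | r1Cap (s : Bool) (i : ℕ) : ReidemeisterMove [cross s i, cap i] [cap i]
  /-- second Reidemeister move -/
  | r2 (s : Bool) (i : ℕ) : ReidemeisterMove [cross s i, cross (!s) i] []
  /-- third Reidemeister move -/
  | r3 (s : Bool) (i : ℕ) :
      ReidemeisterMove [cross s i, cross s (i + 1), cross s i]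
        [cross s (i + 1), cross s i, cross s (i + 1)]

/-- The local form of the `n`-moves and the `-n`-moves: two parallel strands are replaced by `n`
half twists, of either handedness. -/
inductive TwistMove (n : ℕ) : List Slice → List Slice → Prop
  | twist (s : Bool) (i : ℕ) : TwistMove n [] (List.replicate n (cross s i))

/-- `L'` arises from `L` by replacing a part of the word according to the local move `R`; the rest
of the diagram is unchanged. -/
def Step (R : List Slice → List Slice → Prop) (L L' : LinkDiagram) : Prop :=
  ∃ u a b v : List Slice, R a b ∧ L.1 = u ++ a ++ v ∧ L'.1 = u ++ b ++ v

/-- Two diagrams represent the same link. -/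
def Isotopic : LinkDiagram → LinkDiagram → Prop :=
  Relation.EqvGen (Step ReidemeisterMove)

/-- `n`-move equivalence: one link is obtained from the other by finitely many `n`-moves, `-n`-moves
and isotopies. -/
def MoveEquiv (n : ℕ) : LinkDiagram → LinkDiagram → Prop :=
  Relation.EqvGen fun L L' => Step ReidemeisterMove L L' ∨ Step (TwistMove n) L L'

/-! ### Closed braids -/

/-- Words in the standard generators of the braid group on `n` strands and their inverses:
`(i, true)` is `σ_{i+1}` and `(i, false)` is its inverse. -/
abbrev BraidWord (n : ℕ) : Type := List (Fin (n - 1) × Bool)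

/-- The word of slices of the standard closure of a braid: `n` nested minima, the braid on the first
`n` of the `2 n` strands, and `n` nested maxima. -/
def closureWord (n : ℕ) (β : BraidWord n) : List Slice :=
  (List.range n).map cup ++ β.map (fun g => cross g.2 g.1) ++ (List.range n).reverse.map cap

theorem isTangle_cups (n : ℕ) : IsTangle 0 ((List.range n).map cup) (2 * n) := by
  induction n with
  | zero => rfl
  | succ n ih =>
    rw [List.range_succ, List.map_append]
    refine ih.append ⟨?_, ?_⟩
    · change n + 0 ≤ 2 * n
      omega
    · change 2 * n - 0 + 2 = 2 * (n + 1)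
      omega

theorem isTangle_caps (n : ℕ) : IsTangle (2 * n) ((List.range n).reverse.map cap) 0 := by
  induction n with
  | zero => rfl
  | succ n ih =>
    rw [List.range_succ, List.reverse_append]
    refine ⟨?_, ?_⟩
    · change n + 2 ≤ 2 * (n + 1)
      omega
    · have h : (cap n).next (2 * (n + 1)) = 2 * n := by
        change 2 * (n + 1) - 2 + 0 = 2 * n
        omega
      change IsTangle ((cap n).next (2 * (n + 1))) _ 0
      rw [h]
      exact ih

theorem isTangle_braid (n : ℕ) (β : BraidWord n) :
    IsTangle (2 * n) (β.map (fun g => cross g.2 g.1)) (2 * n) := by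
  induction β with
  | nil => rfl
  | cons g β ih =>
    have hg := g.1.2
    refine ⟨?_, ?_⟩
    · change (g.1 : ℕ) + 2 ≤ 2 * n
      omega
    · have h : (cross g.2 g.1).next (2 * n) = 2 * n := by
        change 2 * n - 2 + 2 = 2 * n
        omega
      rw [h]
      exact ih

/-- The closure of a braid. -/
def closure (n : ℕ) (β : BraidWord n) : LinkDiagram :=
  ⟨closureWord n β, ((isTangle_cups n).append (isTangle_braid n β)).append (isTangle_caps n)⟩

/-- The link is a closed braid on `n` strands. -/
def IsClosedBraid (n : ℕ) (L : LinkDiagram) : Prop :=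
  ∃ β : BraidWord n, Isotopic L (closure n β)

/-! ### Particular links -/

/-- The split union: the second diagram is put above the first. -/
def splitUnion (L L' : LinkDiagram) : LinkDiagram := ⟨L.1 ++ L'.1, L.2.append L'.2⟩

/-- The trivial knot: a circle without crossings. -/
def unknot : LinkDiagram := ⟨[cup 0, cap 0], by decide⟩

/-- The trivial link of `n` components: `n` circles that bound disjoint disks in the plane. -/
def trivialLink : ℕ → LinkDiagram
  | 0 => ⟨[], rfl⟩
  | n + 1 => splitUnion (trivialLink n) unknot

/-- The Hopf link: two circles with two crossings, the closure of the braid `σ₁²`. -/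
def hopfLink : LinkDiagram := closure 2 [(0, true), (0, true)]

/-- The connected sum of two words of slices: the first diagram is cut open at its highest point,
the second one is put above it and cut open at its lowest point, and the ends are joined. -/
def connectedSumWord (u v : List Slice) : List Slice := u.dropLast ++ v.tail

/-- The connected sum of two Hopf links. -/
def hopfSum : LinkDiagram := ⟨connectedSumWord hopfLink.1 hopfLink.1, by decide⟩

/-- The torus link of type `(3, 3)`: the closure of the braid `(σ₁ σ₂)³`. -/
def torusLink33 : LinkDiagram :=
  closure 3 [(0, true), (1, true), (0, true), (1, true), (0, true), (1, true)]

/-- The Borromean rings: the closure of the braid `(σ₁ σ₂⁻¹)³`. -/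
def borromeanRings : LinkDiagram :=
  closure 3 [(0, true), (1, false), (0, true), (1, false), (0, true), (1, false)]

end LinkDiagram

/-! The `4`-move class of the closure of a 3-braid does not change when the word is permuted
cyclically, when a braid relation is applied, or when the fourth power of a generator is inserted.
It is therefore a conjugation invariant function on a quotient of the braid group in which the
generators $a$, $b$ satisfy $a^4 = b^4 = 1$. There the full twist $z = (aba)^2$ is central with $z^4
= 1$, and every element has the form $a^i z^j r$ with six choices of $r$ (`exists_normalForm`). So
at most $4 \cdot 4 \cdot 6 = 96$ elements remain, and sixteen explicit ones meet every conjugacy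
class (`forall_of_conj_invariant`).

The closures of these sixteen braids fall into the eight classes `IsBasicClass`. Most are recognized
by removing a strand or splitting off a circle. Two ingredients are moves of the closed link rather
than group relations: turning over the circle formed by the third strand exchanges $ba^2b$ with
$b^{-1}a^{-2}b^{-1}$ (`circle_flip`), and a `4`-move between a braid strand and a returning strand
changes the figure eight knot to the trefoil (`closureWord_figureEight`). The Borromean rings enter
as the closure of $z^2 = (ab^{-1})^3$ (`fullTwist_sq`).

The number of components selects among the eight links. A link with $c$ components has $2^c$
colourings by two colours, and their number is a state sum over the slices that every move preserves
and that `decide` evaluates. -/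

namespace LinkDiagram

/-! ### Colourings and the number of components -/

/-- The state above a minimum: two new strands of colour `b` begin at position `i`. -/
def insertPair (i : ℕ) (b : Bool) (c : ℕ → Bool) (j : ℕ) : Bool :=
  if j < i then c j else if j < i + 2 then b else c (j - 2)

/-- The state above a maximum: the strands number `i` and `i + 1` end. -/
def removePair (i : ℕ) (c : ℕ → Bool) (j : ℕ) : Bool :=
  if j < i then c j else c (j + 2)

/-- The state above a crossing. -/
def swapPair (i : ℕ) (c : ℕ → Bool) (j : ℕ) : Bool :=
  if j = i then c (i + 1) else if j = i + 1 then c i else c j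

/-- The transfer operator of a slice: it sums over all states above the slice that continue a
colouring `c` of the strands below it. -/
def Slice.transfer (x : Slice) (F : (ℕ → Bool) → ℕ) (c : ℕ → Bool) : ℕ :=
  match x.kind with
  | .cup => F (insertPair x.pos false c) + F (insertPair x.pos true c)
  | .cap => if c x.pos = c (x.pos + 1) then F (removePair x.pos c) else 0
  | .cross _ => F (swapPair x.pos c)

/-- The number of colourings of the word `w` that continue the state `c`, weighted by `F`. -/
def transfer (w : List Slice) (F : (ℕ → Bool) → ℕ) : (ℕ → Bool) → ℕ :=
  w.foldr Slice.transfer F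

theorem transfer_append (u v : List Slice) (F : (ℕ → Bool) → ℕ) :
    transfer (u ++ v) F = transfer u (transfer v F) := by
  simp [transfer]

set_option linter.unusedSimpArgs false in
theorem transfer_commute (x y : Kind) (i k : ℕ) (F : (ℕ → Bool) → ℕ) :
    transfer [⟨x, i⟩, ⟨y, i + x.top + k⟩] F = transfer [⟨y, i + x.bot + k⟩, ⟨x, i⟩] F := by
  funext c
  -- The right-hand slice sits at `p` when the left active part has no strands beside it and at `p +
  -- 2` when it has two. All sixteen... nine identities below express that operations at disjoint
  -- places commute up to this shift.
  obtain ⟨p, hp⟩ : ∃ p, p = i + k := ⟨_, rfl⟩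
  have hp0 : i + 0 + k = p := by omega
  have hp2 : i + 2 + k = p + 2 := by omega
  have hi : i ≤ p := by omega
  have e1 : ∀ b b', insertPair (p + 2) b' (insertPair i b c) =
      insertPair i b (insertPair p b' c) := by
    intro b b'; funext j; simp only [insertPair]; grind
  have e2 : ∀ b, removePair (p + 2) (insertPair i b c) = insertPair i b (removePair p c) := by
    intro b; funext j; simp only [insertPair, removePair]; grind
  have e3 : ∀ b, swapPair (p + 2) (insertPair i b c) = insertPair i b (swapPair p c) := by
    intro b; funext j; simp only [insertPair, swapPair]; grind
  have e4 : ∀ b, insertPair p b (removePair i c) =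
      removePair i (insertPair (p + 2) b c) := by
    intro b; funext j; simp only [insertPair, removePair]; grind
  have e5 : removePair p (removePair i c) = removePair i (removePair (p + 2) c) := by
    funext j; simp only [removePair]; grind
  have e6 : swapPair p (removePair i c) = removePair i (swapPair (p + 2) c) := by
    funext j; simp only [swapPair, removePair]; grind
  have e7 : ∀ b, insertPair (p + 2) b (swapPair i c) =
      swapPair i (insertPair (p + 2) b c) := by
    intro b; funext j; simp only [insertPair, swapPair]; grind
  have e8 : removePair (p + 2) (swapPair i c) = swapPair i (removePair (p + 2) c) := by
    funext j; simp only [swapPair, removePair]; grind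
  have e9 : swapPair (p + 2) (swapPair i c) = swapPair i (swapPair (p + 2) c) := by
    funext j; simp only [swapPair]; grind
  have h1 : ∀ b, insertPair i b c (p + 2) = c p := by simp only [insertPair]; grind
  have h1' : ∀ b, insertPair i b c (p + 2 + 1) = c (p + 1) := by simp only [insertPair]; grind
  have h2 : removePair i c p = c (p + 2) := by simp only [removePair]; grind
  have h2' : removePair i c (p + 1) = c (p + 2 + 1) := by simp only [removePair]; grind
  have h3 : swapPair i c (p + 2) = c (p + 2) := by simp only [swapPair]; grind
  have h3' : swapPair i c (p + 2 + 1) = c (p + 2 + 1) := by simp only [swapPair]; grind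
  have h4 : ∀ b, insertPair (p + 2) b c i = c i := by simp only [insertPair]; grind
  have h4' : ∀ b, insertPair (p + 2) b c (i + 1) = c (i + 1) := by simp only [insertPair]; grind
  have h5 : removePair (p + 2) c i = c i := by simp only [removePair]; grind
  have h5' : removePair (p + 2) c (i + 1) = c (i + 1) := by simp only [removePair]; grind
  have h6 : swapPair (p + 2) c i = c i := by simp only [swapPair]; grind
  have h6' : swapPair (p + 2) c (i + 1) = c (i + 1) := by simp only [swapPair]; grind
  cases x <;> cases y <;>
    simp only [transfer, List.foldr, Slice.transfer, Kind.top, Kind.bot, hp0, hp2, e1, e2, e3,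
      e4, e5, e6, e7, e8, e9, h1, h1', h2, h2', h3, h3', h4, h4', h5, h5', h6, h6'] <;>
    grind

theorem transfer_eq_of_reidemeisterMove {a b : List Slice} (h : ReidemeisterMove a b)
    (F : (ℕ → Bool) → ℕ) : transfer a F = transfer b F := by
  cases h with
  | commute x y i k => exact transfer_commute x y i k F
  | zigzagLeft i =>
    funext c
    -- Of the two colours of the new minimum, only the colour `c i` of the old strand passes the
    -- maximum, and it restores the state `c`.
    have e : ∀ b, b = c i → removePair (i + 1) (insertPair i b c) = c := by
      intro b hb; funext j; simp only [insertPair, removePair]; grind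
    have e1 : ∀ b, insertPair i b c (i + 1) = b := by simp only [insertPair]; grind
    have e2 : ∀ b, insertPair i b c (i + 1 + 1) = c i := by simp only [insertPair]; grind
    simp only [transfer, List.foldr, Slice.transfer, cup, cap, e1, e2]
    cases hc : c i <;> simp [e, hc]
  | zigzagRight i =>
    funext c
    have e : ∀ b, b = c i → removePair i (insertPair (i + 1) b c) = c := by
      intro b hb; funext j; simp only [insertPair, removePair]; grind
    have e1 : ∀ b, insertPair (i + 1) b c i = c i := by simp only [insertPair]; grind
    have e2 : ∀ b, insertPair (i + 1) b c (i + 1) = b := by simp only [insertPair]; grind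
    simp only [transfer, List.foldr, Slice.transfer, cup, cap, e1, e2]
    cases hc : c i <;> simp [e, hc]
  | slideCup s i =>
    funext c
    have e : ∀ b, swapPair (i + 1) (insertPair i b c) = swapPair i (insertPair (i + 1) b c) := by
      intro b; funext j; simp only [insertPair, swapPair]; grind
    simp only [transfer, List.foldr, Slice.transfer, cup, cross, e]
  | slideCap s i =>
    funext c
    have e : removePair i (swapPair (i + 1) c) = removePair (i + 1) (swapPair i c) := by
      funext j; simp only [removePair, swapPair]; grind
    have e1 : swapPair (i + 1) c i = c i := by simp only [swapPair]; grind
    have e2 : swapPair (i + 1) c (i + 1) = c (i + 2) := by simp only [swapPair]; grind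
    have e3 : swapPair i c (i + 1) = c i := by simp only [swapPair]; grind
    have e4 : swapPair i c (i + 1 + 1) = c (i + 2) := by simp only [swapPair]; grind
    simp only [transfer, List.foldr, Slice.transfer, cap, cross, e, e1, e2, e3, e4]
  | r1Cup s i =>
    funext c
    have e : ∀ b, swapPair i (insertPair i b c) = insertPair i b c := by
      intro b; funext j; simp only [insertPair, swapPair]; grind
    simp only [transfer, List.foldr, Slice.transfer, cup, cross, e]
  | r1Cap s i =>
    funext c
    have e : removePair i (swapPair i c) = removePair i c := by
      funext j; simp only [removePair, swapPair]; grind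
    have e1 : swapPair i c i = c (i + 1) := by simp only [swapPair]; grind
    have e2 : swapPair i c (i + 1) = c i := by simp only [swapPair]; grind
    simp only [transfer, List.foldr, Slice.transfer, cap, cross, e, e1, e2]
    by_cases h : c i = c (i + 1)
    · exact (if_pos h.symm).trans (if_pos h).symm
    · exact (if_neg (Ne.symm h)).trans (if_neg h).symm
  | r2 s i =>
    funext c
    have e : swapPair i (swapPair i c) = c := by
      funext j; simp only [swapPair]; grind
    simp only [transfer, List.foldr, Slice.transfer, cross, e]
  | r3 s i =>
    funext c
    have e : swapPair i (swapPair (i + 1) (swapPair i c)) =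
        swapPair (i + 1) (swapPair i (swapPair (i + 1) c)) := by
      funext j; simp only [swapPair]; grind
    simp only [transfer, List.foldr, Slice.transfer, cross, e]

/-- An even number of half twists permutes the strands trivially. -/
theorem transfer_eq_of_twistMove {a b : List Slice} (h : TwistMove 4 a b)
    (F : (ℕ → Bool) → ℕ) : transfer a F = transfer b F := by
  cases h with
  | twist s i =>
    funext c
    have e (c : ℕ → Bool) : swapPair i (swapPair i c) = c := by
      funext j; simp only [swapPair]; grind
    simp only [transfer, List.replicate, List.foldr, Slice.transfer, cross, e]

/-- The number of colourings of a diagram by two colours. -/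
def numColourings (L : LinkDiagram) : ℕ := transfer L.1 (fun _ => 1) (fun _ => false)

theorem numColourings_eq_of_moveEquiv {L L' : LinkDiagram} (h : MoveEquiv 4 L L') :
    numColourings L = numColourings L' := by
  induction h with
  | rel L L' h =>
    rcases h with ⟨u, a, b, v, h, hL, hL'⟩ | ⟨u, a, b, v, h, hL, hL'⟩ <;>
      simp only [numColourings, hL, hL', transfer_append]
    · rw [transfer_eq_of_reidemeisterMove h]
    · rw [transfer_eq_of_twistMove h]
  | refl => rfl
  | symm _ _ _ ih => exact ih.symm
  | trans _ _ _ _ _ ih₁ ih₂ => exact ih₁.trans ih₂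

/-! ### Colourings as sequences of states -/

/-- The colours of the strands below and above a slice fit together. -/
def Slice.Fits (x : Slice) (c d : ℕ → Bool) : Prop :=
  (∀ j < x.pos, c j = d j) ∧ (∀ j, c (x.pos + x.kind.bot + j) = d (x.pos + x.kind.top + j)) ∧
  match x.kind with
  | .cup => d x.pos = d (x.pos + 1)
  | .cap => c x.pos = c (x.pos + 1)
  | .cross _ => c x.pos = d (x.pos + 1) ∧ c (x.pos + 1) = d x.pos

theorem fits_cup_iff (i : ℕ) (c d : ℕ → Bool) :
    Slice.Fits ⟨.cup, i⟩ c d ↔ d = insertPair i (d i) c := by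
  simp only [Slice.Fits, Kind.bot, Kind.top]
  constructor
  · rintro ⟨h₁, h₂, h₃⟩
    funext j
    simp only [insertPair]
    have := h₂ (j - (i + 2))
    grind
  · intro h
    refine ⟨fun j hj => ?_, fun j => ?_, ?_⟩ <;> rw [h] <;> simp only [insertPair] <;> grind

theorem fits_cap_iff (i : ℕ) (c d : ℕ → Bool) :
    Slice.Fits ⟨.cap, i⟩ c d ↔ c i = c (i + 1) ∧ d = removePair i c := by
  simp only [Slice.Fits, Kind.bot, Kind.top]
  constructor
  · rintro ⟨h₁, h₂, h₃⟩
    refine ⟨h₃, ?_⟩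
    funext j
    simp only [removePair]
    have := h₂ (j - i)
    grind
  · rintro ⟨h, rfl⟩
    refine ⟨fun j hj => ?_, fun j => ?_, h⟩ <;> simp only [removePair] <;> grind

theorem fits_cross_iff (s : Bool) (i : ℕ) (c d : ℕ → Bool) :
    Slice.Fits ⟨.cross s, i⟩ c d ↔ d = swapPair i c := by
  simp only [Slice.Fits, Kind.bot, Kind.top]
  constructor
  · rintro ⟨h₁, h₂, h₃, h₄⟩
    funext j
    simp only [swapPair]
    have := h₂ (j - (i + 2))
    grind
  · rintro rfl
    refine ⟨fun j hj => ?_, fun j => ?_, ?_, ?_⟩ <;> simp only [swapPair] <;> grind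

/-- The colourings of a word of slices with the state `c` below it: the sequences of states of the
horizontal lines, normalized above the word. -/
def Colouring (w : List Slice) (c : ℕ → Bool) : Type :=
  {g : ℕ → ℕ → Bool // g 0 = c ∧ (∀ (k : ℕ) (x : Slice), w[k]? = some x → x.Fits (g k) (g (k + 1))) ∧
    ∀ k, w.length < k → g k = fun _ => false}

/-- A colouring of a nonempty word is a colouring of the first slice together with a colouring of
the rest. -/
def colouringCons (x : Slice) (w : List Slice) (c : ℕ → Bool) :
    Colouring (x :: w) c ≃ Σ d : {d // x.Fits c d}, Colouring w d.1 where
  toFun g := ⟨⟨g.1 1, by have := g.2.2.1 0 x rfl; rwa [g.2.1] at this⟩, fun k => g.1 (k + 1), rfl,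
    fun k y hy => g.2.2.1 (k + 1) y hy, fun k hk => g.2.2.2 (k + 1) (Nat.succ_lt_succ hk)⟩
  invFun p := ⟨fun k => Nat.casesOn k c p.2.1, rfl, by
    rintro (_ | k) y hy
    · cases hy
      have := p.1.2
      rw [← p.2.2.1] at this
      exact this
    · exact p.2.2.2.1 k y hy, by
    rintro (_ | k) hk
    · cases hk
    · exact p.2.2.2.2 k (Nat.lt_of_succ_lt_succ hk)⟩
  left_inv g := by
    apply Subtype.ext
    funext k
    cases k
    · exact g.2.1.symm
    · rfl
  right_inv p := by
    obtain ⟨⟨d, hd⟩, g, h, hg⟩ := p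
    dsimp only at h
    subst h
    rfl

/-- A state below a minimum has two continuations, indexed by the new colour; below a maximum it has
one or none, and below a crossing exactly one. Finiteness is carried along for the cardinality of
the sigma type. -/
theorem card_colouring (w : List Slice) (c : ℕ → Bool) :
    Finite (Colouring w c) ∧ Nat.card (Colouring w c) = transfer w (fun _ => 1) c := by
  induction w generalizing c with
  | nil =>
    have : Unique (Colouring [] c) :=
      { default := ⟨fun k => Nat.casesOn k c fun _ _ => false, rfl, by simp, by
          rintro (_ | k) hk
          · cases hk
          · rfl⟩
        uniq := by
          rintro ⟨g, hg, -, h⟩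
          apply Subtype.ext
          funext k
          cases k
          · exact hg
          · exact h _ (Nat.succ_pos _) }
    exact ⟨inferInstance, Nat.card_unique⟩
  | cons x w ih =>
    have hfin (d : ℕ → Bool) := (ih d).1
    obtain ⟨_ | _ | s, i⟩ := x
    · let e : Bool ≃ {d // Slice.Fits ⟨.cup, i⟩ c d} :=
        { toFun := fun b => ⟨insertPair i b c, by
            rw [fits_cup_iff]
            congr
            simp [insertPair]⟩
          invFun := fun d => d.1 i
          left_inv := fun b => by simp [insertPair]
          right_inv := fun d => Subtype.ext ((fits_cup_iff i c d.1).1 d.2).symm }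
      have e' := (colouringCons ⟨.cup, i⟩ w c).trans (Equiv.sigmaCongrLeft e).symm
      refine ⟨Finite.of_equiv _ e'.symm, ?_⟩
      rw [Nat.card_congr e', Nat.card_sigma, Fintype.sum_bool, add_comm]
      simp only [transfer, List.foldr, Slice.transfer]
      exact congrArg₂ (· + ·) (ih _).2 (ih _).2
    · by_cases hc : c i = c (i + 1)
      · let u : Unique {d // Slice.Fits ⟨.cap, i⟩ c d} :=
          { default := ⟨removePair i c, (fits_cap_iff i c _).2 ⟨hc, rfl⟩⟩
            uniq := fun d => Subtype.ext ((fits_cap_iff i c d.1).1 d.2).2 }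
        have e' := (colouringCons ⟨.cap, i⟩ w c).trans (Equiv.uniqueSigma _)
        refine ⟨Finite.of_equiv _ e'.symm, ?_⟩
        rw [Nat.card_congr e']
        simp only [transfer, List.foldr, Slice.transfer, if_pos hc]
        exact (ih _).2
      · have : IsEmpty {d // Slice.Fits ⟨.cap, i⟩ c d} :=
          ⟨fun d => hc ((fits_cap_iff i c d.1).1 d.2).1⟩
        have : IsEmpty (Colouring (⟨.cap, i⟩ :: w) c) :=
          (colouringCons ⟨.cap, i⟩ w c).isEmpty
        refine ⟨inferInstance, ?_⟩
        simp [transfer, Slice.transfer, hc]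
    · let u : Unique {d // Slice.Fits ⟨.cross s, i⟩ c d} :=
        { default := ⟨swapPair i c, (fits_cross_iff s i c _).2 rfl⟩
          uniq := fun d => Subtype.ext ((fits_cross_iff s i c d.1).1 d.2) }
      have e' := (colouringCons ⟨.cross s, i⟩ w c).trans (Equiv.uniqueSigma _)
      refine ⟨Finite.of_equiv _ e'.symm, ?_⟩
      rw [Nat.card_congr e']
      simp only [transfer, List.foldr, Slice.transfer]
      exact (ih _).2

/-! ### Colourings as functions on the components -/

theorem widthAt_succ {w : List Slice} {k : ℕ} {x : Slice} (h : w[k]? = some x) :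
    widthAt w (k + 1) = x.next (widthAt w k) := by
  rw [widthAt, List.take_add_one, h]
  simp [widthAt, List.foldl_append]

theorem le_foldl_of_isTangle {w : List Slice} {n m : ℕ} (hw : IsTangle n w m) {k : ℕ} {x : Slice}
    (h : w[k]? = some x) :
    x.pos + x.kind.bot ≤ (w.take k).foldl (fun n x => x.next n) n := by
  induction w generalizing n k with
  | nil => simp at h
  | cons y w ih =>
    cases k with
    | zero => cases h; exact hw.1
    | succ k => exact ih hw.2 h

/-- This keeps the truncated subtraction in `Slice.next` from truncating inside a diagram. -/
theorem le_widthAt (L : LinkDiagram) {k : ℕ} {x : Slice} (h : L.1[k]? = some x) :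
    x.pos + x.kind.bot ≤ widthAt L.1 k :=
  le_foldl_of_isTangle L.2 h

/-- The points outside the diagram are joined only with points outside the diagram. -/
theorem joined_mem_iff (L : LinkDiagram) {p q : ℕ × ℕ} (h : Joined L.1 p q) :
    (p.1 ≤ L.1.length ∧ p.2 < widthAt L.1 p.1) ↔ (q.1 ≤ L.1.length ∧ q.2 < widthAt L.1 q.1) := by
  have hlt {k : ℕ} {x : Slice} (h : L.1[k]? = some x) : k < L.1.length :=
    (List.getElem?_eq_some_iff.1 h).1
  cases h with
  | left k x j hx hj | right k x j hx =>
    have h1 := hlt hx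
    have h2 := le_widthAt L hx
    have h3 := widthAt_succ hx
    simp only [h3, Slice.next]
    omega
  | cup k i hx | cap k i hx | crossLeft k i s hx | crossRight k i s hx =>
    have h1 := hlt hx
    have h2 := le_widthAt L hx
    have h3 := widthAt_succ hx
    simp only [h3, Slice.next, LinkDiagram.cup, LinkDiagram.cap, cross, Kind.bot, Kind.top]
      at h2 ⊢
    omega

/-- States are functions on all of `ℕ`, so the positions beyond the diagram must be shown to carry
no freedom. Such a position continues straight down, outside the diagram, to the bottom line, where
the state is constantly `false`. -/
theorem colouring_eq_false (L : LinkDiagram) (g : Colouring L.1 fun _ => false) (k j : ℕ)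
    (hj : ¬ (k ≤ L.1.length ∧ j < widthAt L.1 k)) : g.1 k j = false := by
  by_cases hk : k ≤ L.1.length
  · induction k generalizing j with
    | zero => rw [g.2.1]
    | succ k ih =>
      obtain ⟨x, hx⟩ : ∃ x, L.1[k]? = some x := ⟨_, List.getElem?_eq_getElem hk⟩
      have h1 := g.2.2.1 k x hx
      have h2 := le_widthAt L hx
      have h3 := widthAt_succ hx
      have h4 : x.pos + x.kind.top ≤ j := by rw [h3, Slice.next] at hj; omega
      obtain ⟨j, rfl⟩ := Nat.exists_eq_add_of_le h4
      rw [← h1.2.1]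
      refine ih _ (fun h => hj ?_) (by omega)
      rw [h3, Slice.next]
      omega
  · rw [g.2.2.2 k (by omega)]

theorem fits_iff_joined (w : List Slice) (g : ℕ → ℕ → Bool) :
    (∀ (k : ℕ) (x : Slice), w[k]? = some x → x.Fits (g k) (g (k + 1))) ↔
      ∀ p q, Joined w p q → g p.1 p.2 = g q.1 q.2 := by
  constructor
  · rintro h p q hpq
    cases hpq with
    | left k x j hx hj => exact (h k x hx).1 j hj
    | right k x j hx => exact (h k x hx).2.1 j
    | cup k i hx => exact (h k _ hx).2.2
    | cap k i hx => exact (h k _ hx).2.2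
    | crossLeft k i s hx => exact (h k _ hx).2.2.1
    | crossRight k i s hx => exact (h k _ hx).2.2.2
  · intro h k x hx
    refine ⟨fun j hj => h _ _ (.left k x j hx hj), fun j => h _ _ (.right k x j hx), ?_⟩
    obtain ⟨_ | _ | s, i⟩ := x
    · exact h _ _ (.cup k i hx)
    · exact h _ _ (.cap k i hx)
    · exact ⟨h _ _ (.crossLeft k i s hx), h _ _ (.crossRight k i s hx)⟩

/-- The colourings of a diagram are the functions on its components. -/
def colouringEquiv (L : LinkDiagram) :
    (Quot (fun p q : Point L.1 => Joined L.1 p.1 q.1) → Bool) ≃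
      Colouring L.1 fun _ => false where
  toFun f := ⟨fun k j => if h : k ≤ L.1.length ∧ j < widthAt L.1 k then f (Quot.mk _ ⟨(k, j), h⟩)
      else false, by
    funext j
    exact dif_neg fun h => absurd h.2 (Nat.not_lt_zero j), by
    rw [fits_iff_joined]
    intro p q h
    have hpq := joined_mem_iff L h
    by_cases hp : p.1 ≤ L.1.length ∧ p.2 < widthAt L.1 p.1
    · rw [dif_pos hp, dif_pos (hpq.1 hp)]
      exact congrArg f (Quot.sound h)
    · rw [dif_neg hp, dif_neg (mt hpq.2 hp)], by
    intro k hk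
    funext j
    exact dif_neg fun h => by omega⟩
  invFun g := Quot.lift (fun p => g.1 p.1.1 p.1.2) fun p q h =>
    (fits_iff_joined L.1 g.1).1 g.2.2.1 p.1 q.1 h
  left_inv f := by
    funext p
    induction p using Quot.ind with
    | mk p => exact dif_pos p.2
  right_inv g := by
    apply Subtype.ext
    funext k j
    change (if h : _ then g.1 k j else false) = g.1 k j
    split_ifs with h
    · rfl
    · exact (colouring_eq_false L g k j h).symm

theorem finite_point (w : List Slice) : Finite (Point w) := by
  let f : Point w → Σ k : Fin (w.length + 1), Fin (widthAt w k) :=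
    fun p => ⟨⟨p.1.1, Nat.lt_succ_of_le p.2.1⟩, ⟨p.1.2, p.2.2⟩⟩
  refine Finite.of_injective f ?_
  rintro ⟨⟨k, j⟩, hp⟩ ⟨⟨k', j'⟩, hq⟩ h
  simp only [f, Sigma.mk.injEq, Fin.mk.injEq] at h
  obtain ⟨rfl, h⟩ := h
  simp only [heq_eq_eq, Fin.mk.injEq] at h
  subst h
  rfl

/-- Colours are constant along arcs, so a colouring is a free choice of colour on each component. -/
theorem numColourings_eq_two_pow (L : LinkDiagram) : numColourings L = 2 ^ L.numComponents := by
  have := finite_point L.1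
  have : Finite (Quot fun p q : Point L.1 => Joined L.1 p.1 q.1) := Quot.finite _
  rw [numColourings, ← (card_colouring _ _).2, ← Nat.card_congr (colouringEquiv L), Nat.card_fun,
    numComponents]
  simp

/-- The cardinality of a quotient is replaced here by the state sum, which evaluates on concrete
diagrams. -/
theorem numComponents_eq_of_moveEquiv {L L' : LinkDiagram} (h : MoveEquiv 4 L L') {n : ℕ}
    (hL' : numColourings L' = 2 ^ n) : L.numComponents = n := by
  rw [← numColourings_eq_of_moveEquiv h, numColourings_eq_two_pow] at hL'
  exact Nat.pow_right_injective le_rfl hL'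

theorem numColourings_unknot : numColourings unknot = 2 ^ 1 := by decide
theorem numColourings_trivialLink_two : numColourings (trivialLink 2) = 2 ^ 2 := by decide
theorem numColourings_hopfLink : numColourings hopfLink = 2 ^ 2 := by decide
theorem numColourings_trivialLink_three : numColourings (trivialLink 3) = 2 ^ 3 := by decide
theorem numColourings_hopfLink_unknot : numColourings (splitUnion hopfLink unknot) = 2 ^ 3 := by
  decide
theorem numColourings_hopfSum : numColourings hopfSum = 2 ^ 3 := by decide
theorem numColourings_torusLink33 : numColourings torusLink33 = 2 ^ 3 := by decide
theorem numColourings_borromeanRings : numColourings borromeanRings = 2 ^ 3 := by decide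

end LinkDiagram

namespace LinkDiagram

/-! ### Moves on words of slices -/

/-- The words `w` and `w'` are tangles from `n` to `m` strands, and they differ by a Reidemeister
move or a `4`-move. -/
def WordStep (n m : ℕ) (w w' : List Slice) : Prop :=
  IsTangle n w m ∧ IsTangle n w' m ∧ ∃ u a b v : List Slice,
    (ReidemeisterMove a b ∨ TwistMove 4 a b) ∧ w = u ++ a ++ v ∧ w' = u ++ b ++ v

/-- The words are equal or represent `4`-move equivalent tangles from `n` to `m` strands. -/
def WordEquiv (n m : ℕ) : List Slice → List Slice → Prop :=
  Relation.EqvGen (WordStep n m)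

namespace WordEquiv

variable {n m : ℕ} {w w' w'' : List Slice}

theorem refl (n m : ℕ) (w : List Slice) : WordEquiv n m w w := Relation.EqvGen.refl w

theorem symm (h : WordEquiv n m w w') : WordEquiv n m w' w := Relation.EqvGen.symm _ _ h

theorem trans (h : WordEquiv n m w w') (h' : WordEquiv n m w' w'') : WordEquiv n m w w'' :=
  Relation.EqvGen.trans _ _ _ h h'

theorem isTangle_iff (h : WordEquiv n m w w') : IsTangle n w m ↔ IsTangle n w' m := by
  induction h with
  | rel _ _ h => exact iff_of_true h.1 h.2.1
  | refl => rfl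
  | symm _ _ _ ih => exact ih.symm
  | trans _ _ _ _ _ ih₁ ih₂ => exact ih₁.trans ih₂

theorem context (h : WordEquiv n m w w') {k l : ℕ} (u v : List Slice) (hu : IsTangle k u n)
    (hv : IsTangle m v l) : WordEquiv k l (u ++ w ++ v) (u ++ w' ++ v) := by
  induction h with
  | rel w w' h =>
    obtain ⟨hw, hw', u', a, b, v', h, rfl, rfl⟩ := h
    exact .rel _ _ ⟨(hu.append hw).append hv, (hu.append hw').append hv,
      u ++ u', a, b, v' ++ v, h, by simp, by simp⟩
  | refl => exact refl _ _ _
  | symm _ _ _ ih => exact ih.symm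
  | trans _ _ _ _ _ ih₁ ih₂ => exact ih₁.trans ih₂

theorem moveEquiv (h : WordEquiv 0 0 w w') (hw : IsTangle 0 w 0) (hw' : IsTangle 0 w' 0) :
    MoveEquiv 4 ⟨w, hw⟩ ⟨w', hw'⟩ := by
  induction h with
  | rel w w' h =>
    obtain ⟨_, _, u, a, b, v, h | h, hw, hw'⟩ := h
    · exact .rel _ _ (.inl ⟨u, a, b, v, h, hw, hw'⟩)
    · exact .rel _ _ (.inr ⟨u, a, b, v, h, hw, hw'⟩)
  | refl => exact .refl _
  | symm _ _ _ ih => exact .symm _ _ (ih _ _)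
  -- The intermediate word must itself be a diagram; this passes along `h` because each step relates
  -- two tangles.
  | trans _ _ _ h _ ih₁ ih₂ => exact .trans _ _ _ (ih₁ _ ((isTangle_iff h).1 hw)) (ih₂ _ _)

theorem of_move {a b : List Slice} (u v : List Slice) (r : ReidemeisterMove a b)
    (h : IsTangle n (u ++ a ++ v) m) (h' : IsTangle n (u ++ b ++ v) m) :
    WordEquiv n m (u ++ a ++ v) (u ++ b ++ v) :=
  .rel _ _ ⟨h, h', u, a, b, v, .inl r, rfl, rfl⟩

/-- Apply a Reidemeister move to the slices from number `k` on. -/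
theorem fwd (k : ℕ) {a b : List Slice} (r : ReidemeisterMove a b)
    (hw : w = w.take k ++ a ++ w.drop (k + a.length))
    (h : decide (IsTangle n w m) = true)
    (h' : decide (IsTangle n (w.take k ++ b ++ w.drop (k + a.length)) m) = true)
    (H : WordEquiv n m (w.take k ++ b ++ w.drop (k + a.length)) w') : WordEquiv n m w w' :=
  .trans (.rel _ _ ⟨of_decide_eq_true h, of_decide_eq_true h', _, a, b, _, .inl r, hw, rfl⟩) H

/-- Apply a Reidemeister move backwards to the slices from number `k` on. -/
theorem bwd (k : ℕ) {a b : List Slice} (r : ReidemeisterMove a b)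
    (hw : w = w.take k ++ b ++ w.drop (k + b.length))
    (h : decide (IsTangle n w m) = true)
    (h' : decide (IsTangle n (w.take k ++ a ++ w.drop (k + b.length)) m) = true)
    (H : WordEquiv n m (w.take k ++ a ++ w.drop (k + b.length)) w') : WordEquiv n m w w' :=
  .trans (.symm (.rel _ _ ⟨of_decide_eq_true h', of_decide_eq_true h, _, a, b, _, .inl r, rfl, hw⟩))
    H

/-- Insert four half twists after the first `k` slices. -/
theorem insert_twist (k i : ℕ) (s : Bool)
    (h : decide (IsTangle n w m) = true)
    (h' : decide (IsTangle n (w.take k ++ List.replicate 4 (cross s i) ++ w.drop k) m) = true)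
    (H : WordEquiv n m (w.take k ++ List.replicate 4 (cross s i) ++ w.drop k) w') :
    WordEquiv n m w w' :=
  .trans (.rel _ _ ⟨of_decide_eq_true h, of_decide_eq_true h', w.take k, [], _, w.drop k,
    .inr (.twist s i), by simp, rfl⟩) H

/-- Replace a part of the word from slice number `k` on by an equivalent one. -/
theorem sub (k : ℕ) {p q : ℕ} {a b : List Slice} (r : WordEquiv p q a b)
    (hw : w = w.take k ++ a ++ w.drop (k + a.length))
    (h : decide (IsTangle n (w.take k) p) = true)
    (h' : decide (IsTangle q (w.drop (k + a.length)) m) = true)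
    (H : WordEquiv n m (w.take k ++ b ++ w.drop (k + a.length)) w') : WordEquiv n m w w' := by
  refine .trans ?_ H
  have := r.context (w.take k) (w.drop (k + a.length)) (of_decide_eq_true h) (of_decide_eq_true h')
  rwa [← hw] at this

end WordEquiv

/-- For a variable `s`, `!!s` does not reduce to `s`; this form lets the explicit isotopies below
match words by `rfl`. -/
theorem ReidemeisterMove.slideCup_not (s : Bool) (i : ℕ) :
    ReidemeisterMove [cup i, cross (!s) (i + 1)] [cup (i + 1), cross s i] := by
  simpa using slideCup (!s) i

theorem ReidemeisterMove.slideCap_not (s : Bool) (i : ℕ) :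
    ReidemeisterMove [cross (!s) (i + 1), cap i] [cross s i, cap (i + 1)] := by
  simpa using slideCap (!s) i

open WordEquiv ReidemeisterMove

/-! ### Explicit isotopies of tangles -/

/-- A crossing of the strands of a closed braid may be moved through the maxima. -/
theorem cross_zero_caps (s : Bool) :
    WordEquiv 6 0 [cross s 0, cap 2, cap 1, cap 0] [cross s 4, cap 2, cap 1, cap 0] := by
  refine fwd 0 (commute _ _ 0 0) rfl rfl rfl ?_
  refine bwd 1 (slideCap_not s 0) rfl rfl rfl ?_
  refine fwd 2 (commute _ _ 0 0) rfl rfl rfl ?_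
  refine bwd 1 (slideCap s 1) rfl rfl rfl ?_
  refine fwd 0 (commute _ _ 2 0) rfl rfl rfl ?_
  exact refl _ _ _

theorem cross_one_caps (s : Bool) :
    WordEquiv 6 0 [cross s 1, cap 2, cap 1, cap 0] [cross s 3, cap 2, cap 1, cap 0] := by
  refine bwd 0 (slideCap_not s 1) rfl rfl rfl ?_
  refine fwd 1 (commute _ _ 1 0) rfl rfl rfl ?_
  refine bwd 0 (slideCap s 2) rfl rfl rfl ?_
  exact refl _ _ _

/-- A crossing of the strands of a closed braid may be moved through the minima. -/
theorem cups_cross_zero (s : Bool) :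
    WordEquiv 0 6 [cup 0, cup 1, cup 2, cross s 0] [cup 0, cup 1, cup 2, cross s 4] := by
  refine bwd 2 (commute (.cross s) .cup 0 0) rfl rfl rfl ?_
  refine bwd 1 (slideCup_not s 0) rfl rfl rfl ?_
  refine bwd 0 (commute .cup .cup 0 0) rfl rfl rfl ?_
  refine bwd 1 (slideCup s 1) rfl rfl rfl ?_
  refine bwd 2 (commute .cup (.cross s) 2 0) rfl rfl rfl ?_
  exact refl _ _ _

theorem cups_cross_one (s : Bool) :
    WordEquiv 0 6 [cup 0, cup 1, cup 2, cross s 1] [cup 0, cup 1, cup 2, cross s 3] := by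
  refine bwd 2 (slideCup_not s 1) rfl rfl rfl ?_
  refine bwd 1 (commute .cup .cup 1 0) rfl rfl rfl ?_
  refine bwd 2 (slideCup s 2) rfl rfl rfl ?_
  exact refl _ _ _

/-- A circle around two strands may be turned over. -/
theorem circle_flip :
    WordEquiv 4 4
      [cup 2, cross true 1, cross true 0, cross true 0, cross true 1, cap 2]
      [cup 2, cross false 1, cross false 0, cross false 0, cross false 1, cap 2] := by
  refine bwd 0 (slideCup_not true 1) rfl rfl rfl ?_
  refine bwd 1 (commute (.cross true) (.cross false) 0 0) rfl rfl rfl ?_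
  refine bwd 0 (slideCup_not true 0) rfl rfl rfl ?_
  -- The minimum of the circle has been dragged to the left of both strands. The kink created here
  -- is carried across them by two third moves and disappears at the maximum; sliding the minimum
  -- back gives the opposite crossings.
  refine bwd 0 (r1Cup false 0) rfl rfl rfl ?_
  refine bwd 3 (commute (.cross true) (.cross false) 0 0) rfl rfl rfl ?_
  refine bwd 1 (r2 true 1) rfl rfl rfl ?_
  refine bwd 2 (r3 false 0) rfl rfl rfl ?_
  refine fwd 4 (r2 false 0) rfl rfl rfl ?_
  refine bwd 3 (r2 true 2) rfl rfl rfl ?_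
  refine bwd 4 (r3 false 1) rfl rfl rfl ?_
  refine fwd 6 (r2 false 1) rfl rfl rfl ?_
  refine fwd 5 (r1Cap false 2) rfl rfl rfl ?_
  refine fwd 0 (slideCup true 0) rfl rfl rfl ?_
  refine fwd 2 (commute _ _ 0 0) rfl rfl rfl ?_
  refine fwd 1 (commute _ _ 0 0) rfl rfl rfl ?_
  refine fwd 0 (slideCup true 1) rfl rfl rfl ?_
  exact refl _ _ _

/-- The third strand of a closed braid that crosses the second one only once may be removed. -/
theorem destabilize (s : Bool) : WordEquiv 4 4 [cup 2, cross s 1, cap 2] [] := by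
  refine bwd 0 (slideCup_not s 1) rfl rfl rfl ?_
  refine fwd 1 (r1Cap _ _) rfl rfl rfl ?_
  refine fwd 0 (zigzagLeft 1) rfl rfl rfl ?_
  exact refl _ _ _

/-- A circle that encircles the third strand of a closed braid after passing the second one
encircles the first one. -/
theorem circle_conjugate :
    WordEquiv 4 4 [cup 2, cross true 1, cross true 0, cross true 0, cross false 1, cap 2]
      [cup 1, cross true 0, cross true 0, cap 1] := by
  refine bwd 0 (slideCup_not true 1) rfl rfl rfl ?_
  refine bwd 4 (slideCap_not false 1) rfl rfl rfl ?_
  refine bwd 1 (commute (.cross true) (.cross false) 0 0) rfl rfl rfl ?_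
  refine bwd 2 (commute (.cross true) (.cross false) 0 0) rfl rfl rfl ?_
  refine fwd 3 (r2 false 2) rfl rfl rfl ?_
  exact refl _ _ _

theorem hopfSum_word :
    WordEquiv 0 0 ([cup 0, cup 1, cross true 0, cross true 0] ++
      [cup 1, cross true 0, cross true 0, cap 1] ++ [cap 1, cap 0]) hopfSum.1 := by
  refine fwd 7 (commute .cap .cap 1 0) rfl rfl rfl ?_
  refine fwd 6 (commute (.cross true) .cap 0 1) rfl rfl rfl ?_
  refine fwd 5 (commute (.cross true) .cap 0 1) rfl rfl rfl ?_
  refine fwd 4 (commute .cup .cap 1 0) rfl rfl rfl ?_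
  exact refl _ _ _

/-- A circle may be moved across a strand. -/
theorem circle_shift {n i : ℕ} (h : i + 1 ≤ n) :
    WordEquiv n n [cup i, cap i] [cup (i + 1), cap (i + 1)] := by
  refine bwd 1 (r2 true (i + 1)) rfl ?_ ?_ ?_
  iterate 2
    simp [IsTangle, cup, cap, cross, Slice.next, Kind.bot, Kind.top]
    omega
  refine fwd 0 (slideCup true i) rfl ?_ ?_ ?_
  iterate 2
    simp [IsTangle, cup, cap, cross, Slice.next, Kind.bot, Kind.top]
    omega
  refine fwd 2 (slideCap false i) rfl ?_ ?_ ?_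
  iterate 2
    simp [IsTangle, cup, cap, cross, Slice.next, Kind.bot, Kind.top]
    omega
  refine fwd 1 (r2 false i) rfl ?_ ?_ ?_
  iterate 2
    simp [IsTangle, cup, cap, cross, Slice.next, Kind.bot, Kind.top]
    omega
  exact refl _ _ _

/-- The circle passes the two returning strands, and on their right it is free to rise above the
maxima. -/
theorem split_circle :
    WordEquiv 4 0 [cup 2, cap 2, cap 1, cap 0] [cap 1, cap 0, cup 0, cap 0] := by
  refine sub 0 (circle_shift (n := 4) (i := 2) (by omega)) rfl rfl rfl ?_
  refine sub 0 (circle_shift (n := 4) (i := 3) (by omega)) rfl rfl rfl ?_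
  refine bwd 1 (commute .cap .cap 1 1) rfl rfl rfl ?_
  refine bwd 0 (commute .cap .cup 1 1) rfl rfl rfl ?_
  refine bwd 2 (commute .cap .cap 0 0) rfl rfl rfl ?_
  refine bwd 1 (commute .cap .cup 0 0) rfl rfl rfl ?_
  exact refl _ _ _

theorem closureWord_two_single (s : Bool) :
    WordEquiv 0 0 (closureWord 2 [(0, s)]) unknot.1 := by
  refine bwd 1 (slideCup_not s 0) rfl rfl rfl ?_
  refine fwd 2 (r1Cap _ 1) rfl rfl rfl ?_
  refine fwd 1 (zigzagLeft 0) rfl rfl rfl ?_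
  exact refl _ _ _

theorem closureWord_two_nil : WordEquiv 0 0 (closureWord 2 []) (trivialLink 2).1 := by
  refine sub 1 (circle_shift (n := 2) (i := 1) (by omega)) rfl rfl rfl ?_
  refine bwd 2 (commute .cap .cap 0 0) rfl rfl rfl ?_
  refine bwd 1 (commute .cap .cup 0 0) rfl rfl rfl ?_
  exact refl _ _ _

/-- The figure eight knot may be changed to the trefoil knot. -/
theorem closureWord_figureEight :
    WordEquiv 0 0 (closureWord 3 [(1, false), (0, true), (1, false), (0, true)])
      (closureWord 3 [(1, true), (0, true), (1, true), (0, true)]) := by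
  refine sub 6 (cross_zero_caps true) rfl rfl rfl ?_
  refine bwd 2 (slideCup_not false 1) rfl rfl rfl ?_
  refine fwd 5 (commute _ _ 1 1) rfl rfl rfl ?_
  refine bwd 6 (slideCap_not false 1) rfl rfl rfl ?_
  -- The slides have turned both crossings of the second and third strand into positive crossings at
  -- position `2`, separated only by crossings at `0` and `4`. They form one double twist, which the
  -- `4`-move replaces by the opposite double twist.
  refine insert_twist 4 2 false rfl rfl ?_
  refine fwd 3 (r2 true 2) rfl rfl rfl ?_
  refine bwd 7 (commute (.cross true) (.cross true) 2 0) rfl rfl rfl ?_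
  refine fwd 6 (commute (.cross true) (.cross true) 0 0) rfl rfl rfl ?_
  refine fwd 5 (r2 false 2) rfl rfl rfl ?_
  refine bwd 4 (commute (.cross true) (.cross false) 0 0) rfl rfl rfl ?_
  refine fwd 5 (commute (.cross false) (.cross true) 2 0) rfl rfl rfl ?_
  refine fwd 2 (slideCup false 1) rfl rfl rfl ?_
  refine fwd 6 (slideCap false 1) rfl rfl rfl ?_
  refine bwd 5 (commute (.cross true) (.cross true) 1 1) rfl rfl rfl ?_
  refine sub 6 (cross_zero_caps true).symm rfl rfl rfl ?_
  exact refl _ _ _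

/-- Crossings of the first two strands. -/
def twists (p : List Bool) : List Slice := p.map fun s => cross s 0

theorem isTangle_twists {n : ℕ} (hn : 2 ≤ n) (p : List Bool) : IsTangle n (twists p) n := by
  induction p with
  | nil => rfl
  | cons s p ih =>
    refine ⟨by simpa [cross, Kind.bot] using hn, ?_⟩
    have h : (cross s 0).next n = n := Nat.sub_add_cancel hn
    rw [h]
    exact ih

theorem cup_twists (p : List Bool) :
    WordEquiv 4 6 (cup 2 :: twists p) (twists p ++ [cup 2]) := by
  induction p with
  | nil => exact refl _ _ _
  | cons s p ih =>
    have h := (of_move (n := 4) (m := 6) [] [] (commute (.cross s) .cup 0 0)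
      (of_decide_eq_true rfl) (of_decide_eq_true rfl)).symm
    have h₁ := h.context [] (twists p) rfl (isTangle_twists (by omega) p)
    have h₂ := ih.context [cross s 0] [] (k := 4) (of_decide_eq_true rfl) rfl
    rw [List.append_nil, List.append_nil] at h₂
    exact h₁.trans h₂

/-- The strands of a closed braid which begin with twists of the first two strands: the third
strand is a tangle on the closure of the twists. -/
theorem closureWord_three (p : List Bool) (q : BraidWord 3) {W : List Slice}
    (h : WordEquiv 4 4 ([cup 2] ++ q.map (fun g => cross g.2 g.1) ++ [cap 2]) W) :
    WordEquiv 0 0 (closureWord 3 (p.map (fun s => (0, s)) ++ q))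
      ([cup 0, cup 1] ++ twists p ++ W ++ [cap 1, cap 0]) := by
  have h₁ := (cup_twists p).context (k := 0) (l := 0) [cup 0, cup 1]
    (q.map (fun g => cross g.2 g.1) ++ [cap 2, cap 1, cap 0])
    (of_decide_eq_true rfl) ((isTangle_braid 3 q).append (isTangle_caps 3))
  have h₂ := h.context (k := 0) (l := 0) ([cup 0, cup 1] ++ twists p) [cap 1, cap 0]
    ((isTangle_cups 2).append (isTangle_twists (by omega) p)) (of_decide_eq_true rfl)
  have e : closureWord 3 (p.map (fun s => (0, s)) ++ q) = [cup 0, cup 1] ++ (cup 2 :: twists p) ++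
      (q.map (fun g => cross g.2 g.1) ++ [cap 2, cap 1, cap 0]) := by
    simp [closureWord, twists, List.range_succ, Function.comp_def]
  rw [e]
  refine h₁.trans ?_
  simpa using h₂

theorem closureWord_two (p : List Bool) :
    closureWord 2 (p.map (fun s => (0, s))) = [cup 0, cup 1] ++ twists p ++ [cap 1, cap 0] := by
  simp [closureWord, twists, List.range_succ, Function.comp_def]

/-- Markov destabilization. -/
theorem closureWord_destabilize (p : List Bool) (s : Bool) :
    WordEquiv 0 0 (closureWord 3 (p.map (fun s => (0, s)) ++ [(1, s)]))
      (closureWord 2 (p.map (fun s => (0, s)))) := by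
  have h := closureWord_three p [(1, s)] (destabilize s)
  rwa [List.append_nil, ← closureWord_two] at h

theorem closureWord_split (p : List Bool) :
    WordEquiv 0 0 (closureWord 3 (p.map (fun s => (0, s))))
      (closureWord 2 (p.map (fun s => (0, s))) ++ unknot.1) := by
  have h := closureWord_three p [] (refl _ _ _)
  have h' := split_circle.context (k := 0) (l := 0) ([cup 0, cup 1] ++ twists p) []
    ((isTangle_cups 2).append (isTangle_twists (by omega) p)) rfl
  rw [List.append_nil] at h
  refine h.trans ?_
  rw [closureWord_two]
  simpa [unknot] using h'

/-- The third strand closes up to a circle around the first two, to which `circle_flip` applies. -/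
theorem closureWord_flip (p : List Bool) :
    WordEquiv 0 0
      (closureWord 3 (p.map (fun s => (0, s)) ++ [(1, true), (0, true), (0, true), (1, true)]))
      (closureWord 3
        (p.map (fun s => (0, s)) ++ [(1, false), (0, false), (0, false), (1, false)])) :=
  (closureWord_three p [(1, true), (0, true), (0, true), (1, true)] circle_flip).trans
    (closureWord_three p [(1, false), (0, false), (0, false), (1, false)] (refl _ _ _)).symm

theorem closureWord_hopfSum :
    WordEquiv 0 0
      (closureWord 3 [(0, true), (0, true), (1, true), (0, true), (0, true), (1, false)])
      hopfSum.1 :=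
  (closureWord_three [true, true] [(1, true), (0, true), (0, true), (1, false)]
    circle_conjugate).trans hopfSum_word

end LinkDiagram

/-! ### The braid group on three strands modulo the fourth powers of the generators -/

section BraidRelation

variable {G : Type*} [Group G] {a b : G}

/-- The full twist on three strands. -/
def fullTwist (a b : G) : G := a * b * a * (a * b * a)

theorem fullTwist_eq_pow (h : a * b * a = b * a * b) : fullTwist a b = a * b * a * b * a * b :=
  calc a * b * a * (a * b * a) = a * b * a * (b * a * b) := by rw [h]
    _ = _ := by group

theorem fullTwist_eq (h : a * b * a = b * a * b) : fullTwist a b = a * a * b * a * a * b :=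
  calc fullTwist a b = a * b * a * b * a * b := fullTwist_eq_pow h
    _ = a * (b * a * b) * a * b := by group
    _ = a * (a * b * a) * a * b := by rw [h]
    _ = _ := by group

theorem fullTwist_swap (h : a * b * a = b * a * b) : fullTwist b a = fullTwist a b := by
  rw [fullTwist, fullTwist, h]

/-- Moving past the half twist $aba$ exchanges $a$ and $b$, so moving past its square fixes both. -/
theorem fullTwist_comm_left (h : a * b * a = b * a * b) : Commute (fullTwist a b) a := by
  have h₁ : a * b * a * a = b * (a * b * a) :=
    calc a * b * a * a = b * a * b * a := by rw [h]
      _ = _ := by group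
  have h₂ : a * b * a * b = a * (a * b * a) :=
    calc a * b * a * b = a * (b * a * b) := by group
      _ = _ := by rw [h]
  calc a * b * a * (a * b * a) * a = a * b * a * (a * b * a * a) := by group
    _ = a * b * a * b * (a * b * a) := by rw [h₁]; group
    _ = a * (a * b * a) * (a * b * a) := by rw [h₂]
    _ = a * fullTwist a b := by rw [fullTwist]; group

theorem fullTwist_comm_right (h : a * b * a = b * a * b) : Commute (fullTwist a b) b := by
  rw [← fullTwist_swap h]
  exact fullTwist_comm_left h.symm

theorem inv_sq_eq (ha : a ^ 4 = 1) : a⁻¹ * a⁻¹ = a * a := by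
  have h : a * a * (a * a) = 1 := by simpa only [pow_succ, pow_zero, one_mul, mul_assoc] using ha
  rw [← mul_inv_rev]
  exact inv_eq_of_mul_eq_one_left h

/-- From $z = b^2ab^2a$ and $b^{-2} = b^2$. In other words, $b^2$ conjugates $a$ to $a^{-1}z$, the
source of most identifications of conjugacy classes below. -/
theorem sq_mul_eq (h : a * b * a = b * a * b) (hb : b ^ 4 = 1) :
    b * b * a = a⁻¹ * fullTwist a b * (b * b) := by
  have hz := fullTwist_eq h.symm
  rw [fullTwist_swap h] at hz
  calc b * b * a = (b * b * a * b * b * a) * a⁻¹ * (b⁻¹ * b⁻¹) := by group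
    _ = fullTwist a b * a⁻¹ * (b * b) := by rw [← hz, inv_sq_eq hb]
    _ = _ := by rw [(fullTwist_comm_left h).inv_right.eq]

theorem mul_sq_mul_eq (h : a * b * a = b * a * b) (ha : a ^ 4 = 1) :
    b * a * a * b = a * a * fullTwist a b := by
  rw [← inv_sq_eq ha, fullTwist_eq h]
  group

/-- This is the entry for $r = ba^{-1}$ times $b$ in the multiplication table of
`exists_normalForm`. -/
theorem mul_inv_mul_eq (h : a * b * a = b * a * b) (ha : a ^ 4 = 1) :
    b * a⁻¹ * b = a⁻¹ * fullTwist a b * (b * a⁻¹) := by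
  have h₁ : a⁻¹ = a * a * a := by
    rw [← inv_sq_eq ha]
    group
  have h₂ : a * (b * a⁻¹ * b) = fullTwist a b * (b * a⁻¹) :=
    calc a * (b * a⁻¹ * b) = a * b * a * (a * a * b) := by rw [h₁]; group
      _ = b * a * (b * a * a * b) := by rw [h]; group
      _ = b * a * (a * a * fullTwist a b) := by rw [mul_sq_mul_eq h ha]
      _ = b * (a * a * a) * fullTwist a b := by group
      _ = _ := by
        rw [← h₁]
        exact ((fullTwist_comm_right h).mul_right (fullTwist_comm_left h).inv_right).symm.eq
  rw [mul_assoc a⁻¹, ← h₂, inv_mul_cancel_left]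

theorem fullTwist_sq (h : a * b * a = b * a * b) (hb : b ^ 4 = 1) :
    a * b⁻¹ * a * b⁻¹ * a * b⁻¹ = fullTwist a b * fullTwist a b := by
  have h₁ : a * b⁻¹ * a = b⁻¹ * fullTwist a b * (a * b⁻¹) := by
    rw [mul_inv_mul_eq h.symm hb, fullTwist_swap h]
  have hza := (fullTwist_comm_left h).eq
  have hzb := (fullTwist_comm_right h).inv_right.eq
  calc a * b⁻¹ * a * b⁻¹ * a * b⁻¹ = b⁻¹ * fullTwist a b * (a * b⁻¹) * b⁻¹ * a * b⁻¹ := by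
        rw [h₁]
    _ = b⁻¹ * fullTwist a b * (a * (b⁻¹ * b⁻¹) * a) * b⁻¹ := by group
    _ = fullTwist a b * b⁻¹ * (a * b * b * a) * b⁻¹ := by
        rw [inv_sq_eq hb, hzb]; group
    _ = fullTwist a b * b⁻¹ * (b * b * fullTwist a b) * b⁻¹ := by
        rw [mul_sq_mul_eq h.symm hb, fullTwist_swap h]
    _ = fullTwist a b * b * (fullTwist a b * b⁻¹) := by group
    _ = _ := by rw [hzb]; group

/-- The element $a^{-1}z$ is conjugate to $a$, so its fourth power $a^{-4}z^4$ is trivial. -/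
theorem fullTwist_pow (h : a * b * a = b * a * b) (ha : a ^ 4 = 1) (hb : b ^ 4 = 1) :
    fullTwist a b ^ 4 = 1 := by
  have h₁ : b * b * a * (b * b)⁻¹ = a⁻¹ * fullTwist a b := by
    rw [sq_mul_eq h hb]; group
  have h₂ : (b * b * a * (b * b)⁻¹) ^ 4 = 1 := by
    rw [conj_pow, ha]; group
  rw [h₁, (fullTwist_comm_left h).symm.inv_left.mul_pow, inv_pow, ha] at h₂
  simpa using h₂

/-- Every element of the group is, up to powers of `a` and of the full twist, one of six
elements. -/
theorem exists_normalForm (h : a * b * a = b * a * b) (ha : a ^ 4 = 1) (hb : b ^ 4 = 1)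
    (hab : Subgroup.closure {a, b} = ⊤) (x : G) :
    ∃ i j : ℤ, ∃ r ∈ ({1, b, b * a, b * a * a, b * a⁻¹, b * b} : Set G),
      x = a ^ i * fullTwist a b ^ j * r := by
  set R : Set G := {1, b, b * a, b * a * a, b * a⁻¹, b * b} with hR
  set z := fullTwist a b with hz
  have hza : Commute z a := fullTwist_comm_left h
  -- The elements of `R` represent right cosets of the subgroup generated by `a` and `z`; this table
  -- shows that right multiplication by a generator maps these cosets among themselves.
  have key : ∀ r ∈ R, ∀ y ∈ ({a, b} : Set G), ∃ i j : ℤ, ∃ r' ∈ R, r * y = a ^ i * z ^ j * r' := by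
    rintro r (rfl | rfl | rfl | rfl | rfl | rfl) y (rfl | rfl)
    · exact ⟨1, 0, 1, by simp [hR], by simp⟩
    · exact ⟨0, 0, y, by simp [hR], by simp⟩
    · exact ⟨0, 0, r * y, by simp [hR], by simp⟩
    · exact ⟨0, 0, y * y, by simp [hR], by simp⟩
    · exact ⟨0, 0, b * y * y, by simp [hR], by simp⟩
    · exact ⟨1, 0, y * a, by simp [hR], by rw [← h]; group⟩
    · refine ⟨0, 0, b * y⁻¹, by simp [hR], ?_⟩
      have h₁ : y⁻¹ = y * y * y := by
        rw [← inv_sq_eq ha]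
        group
      rw [h₁]
      group
    · exact ⟨2, 1, 1, by simp [hR], by rw [mul_sq_mul_eq h ha, zpow_two, zpow_one, mul_one]⟩
    · exact ⟨0, 0, b, by simp [hR], by group⟩
    · exact ⟨-1, 1, y * a⁻¹, by simp [hR], by rw [mul_inv_mul_eq h ha, zpow_one, zpow_neg_one]⟩
    · exact ⟨-1, 1, b * b, by simp [hR], by rw [sq_mul_eq h hb, zpow_one, zpow_neg_one]⟩
    · refine ⟨2, -1, y * a * a, by simp [hR], ?_⟩
      have h₁ : y⁻¹ = y * y * y := by
        rw [← inv_sq_eq hb]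
        group
      have h₂ := mul_sq_mul_eq h ha
      calc y * y * y = y⁻¹ * (a * a * z) * z⁻¹ * (a⁻¹ * a⁻¹) := by rw [← h₁]; group
        _ = y⁻¹ * (y * a * a * y) * z⁻¹ * (a * a) := by rw [h₂, inv_sq_eq ha]
        _ = a * a * (y * z⁻¹) * (a * a) := by group
        _ = a * a * (z⁻¹ * y) * (a * a) := by rw [(fullTwist_comm_right h).inv_left.eq]
        _ = _ := by rw [zpow_two, zpow_neg_one]; group
  have hmul : ∀ x, (∃ i j : ℤ, ∃ r ∈ R, x = a ^ i * z ^ j * r) → ∀ y ∈ ({a, b} : Set G),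
      ∃ i j : ℤ, ∃ r ∈ R, x * y = a ^ i * z ^ j * r := by
    rintro _ ⟨i, j, r, hr, rfl⟩ y hy
    obtain ⟨i', j', r', hr', hy⟩ := key r hr y hy
    refine ⟨i + i', j + j', r', hr', ?_⟩
    calc a ^ i * z ^ j * r * y = a ^ i * z ^ j * (r * y) := mul_assoc _ _ _
      _ = a ^ i * (z ^ j * a ^ i') * z ^ j' * r' := by rw [hy]; group
      _ = a ^ i * (a ^ i' * z ^ j) * z ^ j' * r' := by rw [(hza.zpow_zpow j i').eq]
      _ = _ := by rw [zpow_add, zpow_add]; group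
  have hx : x ∈ Subgroup.closure {a, b} := hab ▸ Subgroup.mem_top x
  induction hx using Subgroup.closure_induction_right with
  | one => exact ⟨0, 0, 1, by simp [hR], by simp⟩
  | mul_right x _ y hy ih => exact hmul x ih y hy
  | mul_inv_cancel x _ y hy ih =>
    have h₁ : y⁻¹ = y * y * y := by
      have : y ^ 4 = 1 := by rcases hy with rfl | rfl <;> assumption
      rw [← inv_sq_eq this]
      group
    have := hmul _ (hmul _ (hmul _ ih y hy) y hy) y hy
    rw [h₁]
    simpa only [mul_assoc] using this

theorem zpow_eq_of_pow_four {x : G} (hx : x ^ 4 = 1) (i : ℤ) :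
    x ^ i = 1 ∨ x ^ i = x ∨ x ^ i = x * x ∨ x ^ i = x⁻¹ := by
  have h₁ : x ^ i = x ^ (i % 4) := by
    conv_lhs => rw [← Int.emod_add_mul_ediv i 4, zpow_add, zpow_mul]
    rw [show x ^ (4 : ℤ) = 1 by exact_mod_cast hx, one_zpow, mul_one]
  have h₂ : i % 4 = 0 ∨ i % 4 = 1 ∨ i % 4 = 2 ∨ i % 4 = 3 := by omega
  rw [h₁]
  rcases h₂ with h | h | h | h <;> rw [h]
  · simp
  · simp
  · exact .inr (.inr (.inl (zpow_two x)))
  · refine .inr (.inr (.inr ?_))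
    rw [show (3 : ℤ) = 4 - 1 by rfl, zpow_sub, show x ^ (4 : ℤ) = 1 by exact_mod_cast hx]
    simp

/-- A conjugation invariant property of the group holds for all elements if it holds for the
following ones. -/
theorem forall_of_conj_invariant (h : a * b * a = b * a * b) (ha : a ^ 4 = 1) (hb : b ^ 4 = 1)
    (hab : Subgroup.closure {a, b} = ⊤) (C : G → Prop) (hC : ∀ x y, C (x * y) → C (y * x))
    (h1 : C 1) (hz : C (a * b * a * b * a * b)) (hz_inv : C (a * a * b⁻¹ * a⁻¹ * a⁻¹ * b⁻¹))
    (hz_sq : C (a * b⁻¹ * a * b⁻¹ * a * b⁻¹))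
    (h_a : C a) (ha_inv : C a⁻¹) (haz : C (a⁻¹ * b * a * a * b))
    (haz_inv : C (a * b⁻¹ * a⁻¹ * a⁻¹ * b⁻¹))
    (haa : C (a * a)) (haaz : C (a * a * b * a * a * b⁻¹))
    (haab : C (a * a * b)) (haab_inv : C (a * a * b⁻¹))
    (h_ab : C (a * b)) (hab_inv : C (a⁻¹ * b⁻¹)) (h_a_inv_b : C (a⁻¹ * b))
    (h8 : C (b⁻¹ * a * b⁻¹ * a)) (x : G) : C x := by
  have hbaab := mul_sq_mul_eq h ha
  have hbba := sq_mul_eq h hb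
  have hza := fullTwist_comm_left h
  have hzb := fullTwist_comm_right h
  have hbab : b⁻¹ * a * b⁻¹ = b * a⁻¹ * b * fullTwist a b := by
    have h₁ : b⁻¹ = b * b * b := by
      rw [← inv_sq_eq hb]
      group
    calc b⁻¹ * a * b⁻¹ = b * (b * b * a) * b⁻¹ := by nth_rw 1 [h₁]; group
      _ = b * a⁻¹ * (fullTwist a b * b) := by rw [hbba]; group
      _ = _ := by rw [hzb.eq]; group
  have hba : a⁻¹ * b * a = b * a * b⁻¹ := by
    calc a⁻¹ * b * a = a⁻¹ * (b * a * b) * b⁻¹ := by group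
      _ = _ := by rw [← h]; group
  have hswap_a : a * b * a * a = b * (a * b * a) := by
    calc a * b * a * a = b * a * b * a := by rw [h]
      _ = _ := by group
  have hswap_b : a * b * a * b = a * (a * b * a) := by
    calc a * b * a * b = a * (b * a * b) := by group
      _ = _ := by rw [h]
  have hz_pow := fullTwist_eq_pow h
  have hz_two := fullTwist_sq h hb
  have hz4 := fullTwist_pow h ha hb
  have hba' := mul_inv_mul_eq h ha
  obtain ⟨i, j, r, hr, rfl⟩ := exists_normalForm h ha hb hab x
  -- All needed identities are recorded, and from here on `z` is only a central element with $z^4 =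
  -- 1$.
  generalize fullTwist a b = z at *
  have hzc (x : G) : Commute z x := by
    have hx : x ∈ Subgroup.closure {a, b} := hab ▸ Subgroup.mem_top x
    induction hx using Subgroup.closure_induction with
    | mem x hx => rcases hx with rfl | rfl <;> assumption
    | one => exact Commute.one_right z
    | mul x y _ _ hx hy => exact hx.mul_right hy
    | inv x _ hx => exact hx.inv_right
  -- If `c` conjugates `w` to $w'z^k$, then it conjugates $wz^j$ to $w'z^{j+k}$ for every `j`. Each
  -- family $wz^j$ is settled by such links to the given representatives.
  have tw (c w w' : G) (k : ℤ) (e : c * w = w' * z ^ k * c) (j : ℤ) :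
      C (w * z ^ j) ↔ C (w' * z ^ (j + k)) := by
    have e' : c * (w * z ^ j) * c⁻¹ = w' * z ^ (j + k) :=
      calc c * (w * z ^ j) * c⁻¹ = w' * z ^ k * (c * z ^ j) * c⁻¹ := by rw [← mul_assoc, e]; group
        _ = w' * z ^ k * (z ^ j * c) * c⁻¹ := by rw [((hzc c).zpow_left j).eq]
        _ = _ := by group
    constructor <;> intro H
    · rw [← e']
      refine hC c⁻¹ _ ?_
      rwa [inv_mul_cancel_left]
    · rw [← e'] at H
      have := hC _ _ H
      rwa [inv_mul_cancel_left] at this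
  have four {w : G} (h₀ : C (w * z ^ (0 : ℤ))) (h₁ : C (w * z ^ (1 : ℤ)))
      (h₂ : C (w * z ^ (2 : ℤ))) (h₃ : C (w * z ^ (-1 : ℤ))) (j : ℤ) : C (w * z ^ j) := by
    rw [zpow_zero] at h₀
    rw [zpow_one] at h₁
    rw [zpow_two] at h₂
    rw [zpow_neg_one] at h₃
    rcases zpow_eq_of_pow_four hz4 j with e | e | e | e <;> rw [e] <;> assumption
  have three (w : G) : C (w * z ^ (3 : ℤ)) ↔ C (w * z ^ (-1 : ℤ)) := by
    rw [show (3 : ℤ) = -1 + 4 by rfl, zpow_add, show z ^ (4 : ℤ) = 1 by exact_mod_cast hz4, mul_one]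
  have zero {w : G} : C w → C (w * z ^ (0 : ℤ)) := by simp
  have c_1 : ∀ j : ℤ, C (1 * z ^ j) := by
    refine four (zero h1) (by simpa [hz_pow] using hz) (by rwa [zpow_two, one_mul, ← hz_two]) ?_
    have : a * a * b⁻¹ * a⁻¹ * a⁻¹ * b⁻¹ = z⁻¹ :=
      calc a * a * b⁻¹ * a⁻¹ * a⁻¹ * b⁻¹ = a * a * (b * a * a * b)⁻¹ := by group
        _ = z⁻¹ := by rw [hbaab, mul_inv_rev, (hzc (a * a)).inv_inv.eq]; group
    simpa [this] using hz_inv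
  have tw_a := tw (b * b) a a⁻¹ 1 (by rw [hbba, zpow_one])
  have c_a : ∀ j : ℤ, C (a * z ^ j) := by
    refine four (zero h_a) ?_ ((tw_a 2).2 ((three _).2 ?_)) ((tw_a (-1)).2 (zero ha_inv))
    · have : a⁻¹ * b * a * a * b = a * z :=
        calc a⁻¹ * b * a * a * b = a⁻¹ * (b * a * a * b) := by group
          _ = _ := by rw [hbaab]; group
      rwa [zpow_one, ← this]
    · have : a * b⁻¹ * a⁻¹ * a⁻¹ * b⁻¹ = a⁻¹ * z⁻¹ :=
        calc a * b⁻¹ * a⁻¹ * a⁻¹ * b⁻¹ = a * (b * a * a * b)⁻¹ := by group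
          _ = a * (z⁻¹ * (a * a)⁻¹) := by rw [hbaab, mul_inv_rev]
          _ = a * ((a * a)⁻¹ * z⁻¹) := by rw [(hzc (a * a)).inv_inv.eq]
          _ = _ := by group
      rwa [zpow_neg_one, ← this]
  have c_a_inv (j : ℤ) : C (a⁻¹ * z ^ j) := by
    have := (tw_a (j - 1)).1 (c_a _)
    rwa [sub_add_cancel] at this
  have tw_aa := tw (b * b) (a * a) (a * a) 2 <| by
    calc b * b * (a * a) = b * b * a * a := by group
      _ = a⁻¹ * z * (b * b) * a := by rw [hbba]
      _ = a⁻¹ * z * (b * b * a) := by group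
      _ = a⁻¹ * z * (a⁻¹ * z * (b * b)) := by rw [hbba]
      _ = a⁻¹ * (z * a⁻¹) * z * (b * b) := by group
      _ = a⁻¹ * a⁻¹ * (z * z) * (b * b) := by rw [(hzc a⁻¹).eq]; group
      _ = _ := by rw [inv_sq_eq ha, zpow_two]
  have tw_bb := tw (a * b * a) (b * b) (a * a) 0 <| by
    calc a * b * a * (b * b) = a * b * a * b * b := by group
      _ = a * (a * b * a) * b := by rw [hswap_b]
      _ = a * (a * b * a * b) := by group
      _ = a * (a * (a * b * a)) := by rw [hswap_b]
      _ = _ := by group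
  -- Since $a^2$ is conjugate to $a^2z^2$, only the parity of `j` matters.
  have c_aa : ∀ j : ℤ, C (a * a * z ^ j) := by
    have c₁ : C (a * a * z ^ (1 : ℤ)) := by
      refine (tw_bb 1).1 ?_
      have : a * a * b * a * a * b⁻¹ = b * b * z :=
        calc a * a * b * a * a * b⁻¹ = a * a * (b * a * a * b) * (b⁻¹ * b⁻¹) := by group
          _ = a * a * (a * a) * (z * (b * b)) := by rw [hbaab, inv_sq_eq hb]; group
          _ = a⁻¹ * a⁻¹ * (a * a) * (b * b * z) := by rw [(hzc (b * b)).eq, inv_sq_eq ha]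
          _ = _ := by group
      rwa [zpow_one, ← this]
    exact four (zero haa) c₁ ((tw_aa 0).1 (zero haa)) ((tw_aa (-1)).2 c₁)
  have c_bb (j : ℤ) : C (b * b * z ^ j) := (tw_bb j).2 (c_aa _)
  have tw_aab := tw b (a * a * b) (a * a * b⁻¹) 1 <| by
    calc b * (a * a * b) = b * a * a * b := by group
      _ = a * a * (z * (b⁻¹ * b)) := by rw [hbaab]; group
      _ = _ := by rw [← mul_assoc z, (hzc b⁻¹).eq]; group
  have tw_aab' := tw (b * a) (a * a * b) (b * b * a⁻¹) (-1) <| by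
    have h₁ : a⁻¹ = a * a * a := by
      rw [← inv_sq_eq ha]
      group
    have h₂ : b⁻¹ = b * b * b := by
      rw [← inv_sq_eq hb]
      group
    calc b * a * (a * a * b) = b * a⁻¹ * b * z * z⁻¹ := by rw [h₁]; group
      _ = b⁻¹ * a * b⁻¹ * z⁻¹ := by rw [hbab]
      _ = b * b * (b * a * b⁻¹) * z⁻¹ := by nth_rw 1 [h₂]; group
      _ = b * b * a⁻¹ * (b * a * z⁻¹) := by rw [← hba]; group
      _ = _ := by rw [← (hzc (b * a)).inv_left.eq, zpow_neg_one]; group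
  have tw_bba_inv := tw (a * b * a) (b * b * a⁻¹) (a * a * b⁻¹) 0 <| by
    have h₁ : a * b * a * a⁻¹ = b⁻¹ * (a * b * a) := by
      rw [eq_inv_mul_iff_mul_eq, ← mul_assoc, ← hswap_a]; group
    calc a * b * a * (b * b * a⁻¹) = a * b * a * b * b * a⁻¹ := by group
      _ = a * (a * b * a) * b * a⁻¹ := by rw [hswap_b]
      _ = a * (a * b * a * b) * a⁻¹ := by group
      _ = a * (a * (a * b * a)) * a⁻¹ := by rw [hswap_b]
      _ = a * a * (a * b * a * a⁻¹) := by group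
      _ = _ := by rw [h₁]; group
  have tw_bba := tw (a * b * a) (b * b * a) (a * a * b) 0 <| by
    calc a * b * a * (b * b * a) = a * b * a * b * b * a := by group
      _ = a * (a * b * a) * b * a := by rw [hswap_b]
      _ = a * (a * b * a * b) * a := by group
      _ = a * (a * (a * b * a)) * a := by rw [hswap_b]
      _ = a * a * (a * b * a * a) := by group
      _ = _ := by rw [hswap_a]; group
  have c_aab : ∀ j : ℤ, C (a * a * b * z ^ j) := by
    refine four (zero haab) ((tw_aab' 1).2 ((tw_bba_inv _).2 (zero haab_inv)))
      ((tw_aab' 2).2 ((tw_bba_inv _).2 ((tw_aab 0).1 (zero haab)))) ((tw_aab _).2 (zero haab_inv))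
  have c_bba (j : ℤ) : C (b * b * a * z ^ j) := (tw_bba j).2 (c_aab _)
  have tw_ab := tw (b * b) (a * b) (a⁻¹ * b) 1 <| by
    calc b * b * (a * b) = b * b * a * b := by group
      _ = a⁻¹ * (z * b) * (b * b) := by rw [hbba]; group
      _ = _ := by rw [(hzc b).eq]; group
  have tw_a_inv_b := tw (a * a) (a⁻¹ * b) (a⁻¹ * b⁻¹) 1 <| by
    calc a * a * (a⁻¹ * b) = a⁻¹ * b⁻¹ * (b * a * a * b) := by group
      _ = a⁻¹ * b⁻¹ * (a * a * z) := by rw [hbaab]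
      _ = _ := by rw [← (hzc (a * a)).eq]; group
  -- An equality, not a proper conjugation: the figure eight word is $a^{-1}bz^2$, which is
  -- conjugate to $abz$.
  have tw_8 := tw 1 (b⁻¹ * a * b⁻¹ * a) (a⁻¹ * b) 2 <| by
    calc 1 * (b⁻¹ * a * b⁻¹ * a) = b⁻¹ * a * b⁻¹ * a := by group
      _ = a⁻¹ * z * (b * a⁻¹) * (z * a) := by rw [hbab, hba']; group
      _ = a⁻¹ * (z * b) * z := by rw [(hzc a).eq]; group
      _ = _ := by rw [(hzc b).eq, zpow_two, mul_one]; group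
  have c_ab : ∀ j : ℤ, C (a * b * z ^ j) :=
    four (zero h_ab) ((tw_ab 1).2 ((tw_8 0).1 (zero h8)))
      ((tw_ab 2).2 ((three _).2 ((tw_a_inv_b _).2 (zero hab_inv)))) ((tw_ab _).2 (zero h_a_inv_b))
  have c_a_inv_b (j : ℤ) : C (a⁻¹ * b * z ^ j) := by
    have := (tw_ab (j - 1)).1 (c_ab _)
    rwa [sub_add_cancel] at this
  have c_pow (i j : ℤ) : C (a ^ i * z ^ j) := by
    rcases zpow_eq_of_pow_four ha i with e | e | e | e <;> rw [e]
    exacts [c_1 j, c_a j, c_aa j, c_a_inv j]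
  have c_pow_b (i j : ℤ) : C (a ^ i * b * z ^ j) := by
    rcases zpow_eq_of_pow_four ha i with e | e | e | e <;> rw [e]
    · exact (tw (a * b * a) (1 * b) a 0 (by rw [one_mul, hswap_b]; group) j).2 (c_a _)
    · exact c_ab j
    · exact c_aab j
    · exact c_a_inv_b j
  have c_pow_bb (i j : ℤ) : C (a ^ i * (b * b) * z ^ j) := by
    rcases zpow_eq_of_pow_four ha i with e | e | e | e <;> rw [e]
    · rw [one_mul]
      exact c_bb j
    · exact (tw (b * b) (a * (b * b)) (b * b * a) 0 (by group) j).2 (c_bba _)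
    · refine (tw b (a * a * (b * b)) (a * a) 1 ?_ j).2 (c_aa _)
      calc b * (a * a * (b * b)) = b * a * a * b * b := by group
        _ = _ := by rw [hbaab]; group
    · refine (tw 1 (a⁻¹ * (b * b)) (b * b * a) (-1) ?_ j).2 (c_bba _)
      rw [hbba, mul_assoc a⁻¹, (hzc (b * b)).eq]
      group
  -- Cyclic rotation brings the final $a^k$ to the front, so the four normal forms with $r = ba^k$
  -- reduce to $a^{i+k}bz^j$.
  have c_pow_b_mul (k : ℤ) : C (a ^ i * z ^ j * (b * a ^ k)) := by
    have := c_pow_b (k + i) j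
    rw [zpow_add] at this
    have e := hC (a ^ k) (a ^ i * b * z ^ j) (by simpa only [mul_assoc] using this)
    have e' : a ^ i * z ^ j * (b * a ^ k) = a ^ i * b * z ^ j * a ^ k := by
      rw [mul_assoc (a ^ i) b, ← ((hzc b).zpow_left j).eq]
      group
    rwa [e']
  rcases hr with rfl | rfl | rfl | rfl | rfl | rfl
  · rw [mul_one]
    exact c_pow i j
  · simpa using c_pow_b_mul 0
  · simpa using c_pow_b_mul 1
  · simpa only [zpow_two, mul_assoc] using c_pow_b_mul 2
  · simpa using c_pow_b_mul (-1)
  · rw [mul_assoc, ((hzc (b * b)).zpow_left j).eq, ← mul_assoc]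
    exact c_pow_bb i j

end BraidRelation

namespace LinkDiagram

open WordEquiv ReidemeisterMove

/-! ### Closed braids on three strands -/

/-- The slices of a braid on three strands. -/
def braidSlices (β : BraidWord 3) : List Slice := β.map fun g => cross g.2 g.1

theorem braidSlices_append (β γ : BraidWord 3) :
    braidSlices (β ++ γ) = braidSlices β ++ braidSlices γ :=
  List.map_append

theorem isTangle_braidSlices (β : BraidWord 3) : IsTangle 6 (braidSlices β) 6 := isTangle_braid 3 β

theorem closure_val (β : BraidWord 3) :
    (closure 3 β).1 = [cup 0, cup 1, cup 2] ++ braidSlices β ++ [cap 2, cap 1, cap 0] :=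
  rfl

/-- A crossing of the returning strands of a closed braid may be moved along the braid. -/
theorem cross_braidSlices (s : Bool) (i : Fin 2) (β : BraidWord 3) :
    WordEquiv 6 6 (cross s (4 - i) :: braidSlices β) (braidSlices β ++ [cross s (4 - i)]) := by
  induction β with
  | nil => exact refl _ _ _
  | cons g β ih =>
    obtain ⟨j, t⟩ := g
    have h : WordEquiv 6 6 [cross s (4 - i), cross t j] [cross t j, cross s (4 - i)] := by
      fin_cases i <;> fin_cases j
      · exact bwd 0 (commute (.cross t) (.cross s) 0 2) rfl rfl rfl (refl _ _ _)
      · exact bwd 0 (commute (.cross t) (.cross s) 1 1) rfl rfl rfl (refl _ _ _)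
      · exact bwd 0 (commute (.cross t) (.cross s) 0 1) rfl rfl rfl (refl _ _ _)
      · exact bwd 0 (commute (.cross t) (.cross s) 1 0) rfl rfl rfl (refl _ _ _)
    have h₁ := h.context [] (braidSlices β) rfl (isTangle_braidSlices β)
    have h₂ := ih.context (braidSlices [(j, t)]) [] (isTangle_braidSlices _) rfl
    rw [List.append_nil, List.append_nil] at h₂
    exact h₁.trans h₂

/-- The first crossing passes through the minima to the returning strands, moves up beside the
braid, and comes back through the maxima. Braid strand `i` returns as strand `5 - i`, hence the
position `4 - i`. -/
theorem closure_cons (g : Fin (3 - 1) × Bool) (β : BraidWord 3) :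
    WordEquiv 0 0 (closure 3 (g :: β)).1 (closure 3 (β ++ [g])).1 := by
  obtain ⟨i, s⟩ := g
  have h₁ : WordEquiv 0 6 [cup 0, cup 1, cup 2, cross s i]
      [cup 0, cup 1, cup 2, cross s (4 - i)] := by
    fin_cases i
    · exact cups_cross_zero s
    · exact cups_cross_one s
  have h₂ : WordEquiv 6 0 [cross s (4 - i), cap 2, cap 1, cap 0]
      [cross s i, cap 2, cap 1, cap 0] := by
    fin_cases i
    · exact (cross_zero_caps s).symm
    · exact (cross_one_caps s).symm
  have h₃ := h₁.context [] (braidSlices β ++ [cap 2, cap 1, cap 0]) rfl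
    ((isTangle_braidSlices β).append (isTangle_caps 3))
  have h₄ := (cross_braidSlices s i β).context [cup 0, cup 1, cup 2] [cap 2, cap 1, cap 0]
    (isTangle_cups 3) (isTangle_caps 3)
  have h₅ := h₂.context ([cup 0, cup 1, cup 2] ++ braidSlices β) []
    ((isTangle_cups 3).append (isTangle_braidSlices β)) rfl
  rw [List.append_nil, List.append_nil] at h₅
  rw [closure_val, closure_val, braidSlices_append]
  simp only [List.append_assoc, List.cons_append, List.nil_append] at h₃ h₄ h₅ ⊢
  exact (h₃.trans h₄).trans h₅

theorem closure_append_comm (β γ : BraidWord 3) :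
    WordEquiv 0 0 (closure 3 (β ++ γ)).1 (closure 3 (γ ++ β)).1 := by
  induction γ generalizing β with
  | nil => rw [List.append_nil]; exact refl _ _ _
  | cons g γ ih =>
    have h₁ := ih (β ++ [g])
    have h₂ := (closure_cons g (γ ++ β)).symm
    rw [List.append_assoc] at h₁ h₂
    exact h₁.trans h₂

theorem closure_congr {γ γ' : BraidWord 3} (h : WordEquiv 6 6 (braidSlices γ) (braidSlices γ'))
    (β δ : BraidWord 3) :
    WordEquiv 0 0 (closure 3 (β ++ γ ++ δ)).1 (closure 3 (β ++ γ' ++ δ)).1 := by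
  have := h.context ([cup 0, cup 1, cup 2] ++ braidSlices β)
    (braidSlices δ ++ [cap 2, cap 1, cap 0])
    ((isTangle_cups 3).append (isTangle_braidSlices β))
    ((isTangle_braidSlices δ).append (isTangle_caps 3))
  simpa only [closure_val, braidSlices_append, List.append_assoc] using this

/-! ### The closure as a class function on a quotient of the braid group -/

/-- Links up to `4`-move equivalence. -/
def moveSetoid : Setoid LinkDiagram := ⟨MoveEquiv 4, Relation.EqvGen.is_equivalence _⟩

/-- The class of a link up to `4`-move equivalence. -/
def moveClass (L : LinkDiagram) : Quotient moveSetoid := Quotient.mk _ L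

theorem moveClass_eq {L L' : LinkDiagram} (h : WordEquiv 0 0 L.1 L'.1) :
    moveClass L = moveClass L' :=
  Quotient.sound (h.moveEquiv L.2 L'.2)

/-- The class of the closure of an element of the free group on the generators of the braid
group. -/
def closureClass : FreeGroup (Fin 2) → Quotient moveSetoid :=
  Quot.lift (fun β : BraidWord 3 => moveClass (closure 3 β)) <| by
    -- A reduction step of the free group deletes two inverse letters, which is a second
    -- Reidemeister move.
    rintro _ _ (@⟨β, γ, i, s⟩)
    refine moveClass_eq ?_
    have h : WordEquiv 6 6 (braidSlices [(i, s), (i, !s)]) (braidSlices []) := by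
      fin_cases i
      · exact fwd 0 (r2 s 0) rfl rfl rfl (refl _ _ _)
      · exact fwd 0 (r2 s 1) rfl rfl rfl (refl _ _ _)
    simpa using closure_congr h β γ

theorem closureClass_mul_comm (x y : FreeGroup (Fin 2)) :
    closureClass (x * y) = closureClass (y * x) := by
  induction x using Quot.ind with | mk β
  induction y using Quot.ind with | mk γ
  exact moveClass_eq (closure_append_comm β γ)

theorem closureClass_congr {γ γ' : BraidWord 3}
    (h : WordEquiv 6 6 (braidSlices γ) (braidSlices γ')) (x : FreeGroup (Fin 2)) :
    closureClass (x * FreeGroup.mk γ) = closureClass (x * FreeGroup.mk γ') := by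
  induction x using Quot.ind with | mk β
  have := closure_congr h β []
  rw [List.append_nil, List.append_nil] at this
  exact moveClass_eq this

/-- The elements of the free group that do not change the class of a closed braid. -/
def trivialBraids : Subgroup (FreeGroup (Fin 2)) where
  carrier := {n | ∀ x, closureClass (x * n) = closureClass x}
  one_mem' x := by rw [mul_one]
  mul_mem' hm hn x := by rw [← mul_assoc, hn, hm]
  inv_mem' {n} hn x := by rw [← hn (x * n⁻¹), inv_mul_cancel_right]

/-- Invariance under cyclic permutation moves the conjugating element to the other side of `x`. -/
instance : trivialBraids.Normal where
  conj_mem n hn g x := by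
    rw [← mul_assoc, closureClass_mul_comm, ← mul_assoc, ← mul_assoc, hn, closureClass_mul_comm,
      mul_inv_cancel_left]

/-- The class of the closure of a braid in the quotient of the braid group. -/
def quotientClosureClass : FreeGroup (Fin 2) ⧸ trivialBraids → Quotient moveSetoid :=
  Quotient.lift closureClass fun x y h => by
    have := QuotientGroup.leftRel_apply.1 h x
    rw [mul_inv_cancel_left] at this
    exact this.symm

theorem quotientClosureClass_mul_comm (x y : FreeGroup (Fin 2) ⧸ trivialBraids) :
    quotientClosureClass (x * y) = quotientClosureClass (y * x) := by
  induction x using QuotientGroup.induction_on with | H x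
  induction y using QuotientGroup.induction_on with | H y
  exact closureClass_mul_comm x y

/-- The generators in the quotient of the braid group. -/
def generator (i : Fin 2) : FreeGroup (Fin 2) ⧸ trivialBraids := QuotientGroup.mk (FreeGroup.of i)

/-- Local moves on braid words become relations in the quotient group. -/
theorem mk_eq_of_wordEquiv {γ γ' : BraidWord 3}
    (h : WordEquiv 6 6 (braidSlices γ) (braidSlices γ')) :
    (QuotientGroup.mk (FreeGroup.mk γ) : FreeGroup (Fin 2) ⧸ trivialBraids) =
      QuotientGroup.mk (FreeGroup.mk γ') := by
  refine QuotientGroup.eq.2 fun x => ?_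
  rw [← mul_assoc, ← closureClass_congr h, inv_mul_cancel_right]

theorem generator_braid :
    generator 0 * generator 1 * generator 0 = generator 1 * generator 0 * generator 1 :=
  mk_eq_of_wordEquiv (γ := [(0, true), (1, true), (0, true)])
    (γ' := [(1, true), (0, true), (1, true)])
    (fwd 0 (r3 true 0) rfl rfl rfl (refl _ _ _))

theorem generator_pow_four (i : Fin 2) : generator i ^ 4 = 1 := by
  refine mk_eq_of_wordEquiv (γ := [(i, true), (i, true), (i, true), (i, true)]) (γ' := []) ?_
  fin_cases i
  · exact (insert_twist 0 0 true rfl rfl (refl _ _ _)).symm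
  · exact (insert_twist 0 1 true rfl rfl (refl _ _ _)).symm

theorem closure_generator : Subgroup.closure {generator 0, generator 1} = ⊤ := by
  have h := FreeGroup.closure_range_of (Fin 2)
  have h' := congrArg (Subgroup.map (QuotientGroup.mk' trivialBraids)) h
  rw [MonoidHom.map_closure, ← Set.range_comp, Subgroup.map_top_of_surjective _
    (QuotientGroup.mk'_surjective _)] at h'
  rw [← h']
  congr 1
  ext x
  simp [generator, eq_comm]

/-- The links of the classification. -/
def IsBasicClass (c : Quotient moveSetoid) : Prop :=
  c = moveClass unknot ∨ c = moveClass (trivialLink 2) ∨ c = moveClass hopfLink ∨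
  c = moveClass (trivialLink 3) ∨ c = moveClass (splitUnion hopfLink unknot) ∨
  c = moveClass hopfSum ∨ c = moveClass torusLink33 ∨ c = moveClass borromeanRings

/-! ### Closures of the sixteen representatives -/

theorem moveClass_splitUnion {L L' : LinkDiagram} (h : WordEquiv 0 0 L.1 L'.1) :
    moveClass (splitUnion L unknot) = moveClass (splitUnion L' unknot) := by
  have := h.context [] unknot.1 rfl unknot.2
  exact moveClass_eq this

theorem moveClass_three_nil : moveClass (closure 3 []) = moveClass (trivialLink 3) :=
  (moveClass_eq (L' := splitUnion (closure 2 []) unknot) (closureWord_split [])).trans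
    (moveClass_splitUnion (L' := trivialLink 2) closureWord_two_nil)

theorem moveClass_three_single (s : Bool) :
    moveClass (closure 3 [(0, s)]) = moveClass (trivialLink 2) := by
  refine (moveClass_eq (L' := splitUnion (closure 2 [(0, s)]) unknot)
    (closureWord_split [s])).trans ?_
  exact moveClass_splitUnion (L' := trivialLink 1) (closureWord_two_single s)

theorem moveClass_three_double :
    moveClass (closure 3 [(0, true), (0, true)]) = moveClass (splitUnion hopfLink unknot) :=
  moveClass_eq (closureWord_split [true, true])

theorem moveClass_hopf (s : Bool) :
    moveClass (closure 3 [(0, true), (0, true), (1, s)]) = moveClass hopfLink :=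
  moveClass_eq (closureWord_destabilize [true, true] s)

theorem moveClass_unknot (s t : Bool) :
    moveClass (closure 3 [(0, s), (1, t)]) = moveClass unknot :=
  moveClass_eq ((closureWord_destabilize [s] t).trans (closureWord_two_single s))

/-- The flip turns $ba^2b = a^2z$ into $b^{-1}a^{-2}b^{-1} = a^2z^{-1}$. Thus $az$ becomes
$az^{-1}$, which is $a^{-1}$ conjugated by $b^2$. -/
theorem moveClass_inv_flip :
    moveClass (closure 3 [(0, false), (1, true), (0, true), (0, true), (1, true)]) =
      moveClass (trivialLink 2) := by
  have h := generator_braid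
  have ha := generator_pow_four 0
  have hb := generator_pow_four 1
  set a := generator 0
  set b := generator 1
  have e : a⁻¹ * b⁻¹ * a⁻¹ * a⁻¹ * b⁻¹ = b * b * (a⁻¹ * (b * b)⁻¹) :=
    calc a⁻¹ * b⁻¹ * a⁻¹ * a⁻¹ * b⁻¹ = (b * a * a * b * a)⁻¹ := by group
      _ = (a⁻¹ * a⁻¹ * (fullTwist a b * a))⁻¹ := by
        rw [mul_sq_mul_eq h ha, inv_sq_eq ha, mul_assoc]
      _ = (a⁻¹ * fullTwist a b * (b * b) * (b * b)⁻¹)⁻¹ := by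
        rw [(fullTwist_comm_left h).eq]; group
      _ = _ := by 
        rw [← sq_mul_eq h hb]; simp only [mul_inv_rev, inv_inv, mul_assoc]
  calc moveClass (closure 3 [(0, false), (1, true), (0, true), (0, true), (1, true)]) =
      quotientClosureClass (a⁻¹ * b⁻¹ * a⁻¹ * a⁻¹ * b⁻¹) :=
        moveClass_eq (closureWord_flip [false])
    _ = quotientClosureClass a⁻¹ := by
      rw [e, quotientClosureClass_mul_comm, inv_mul_cancel_right]
    _ = _ := moveClass_three_single false

/-- Here the flip turns $a^{-1}z^{-1}$ into $a^{-1}z$, which is $a$ conjugated by $b^2$. -/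
theorem moveClass_flip :
    moveClass (closure 3 [(0, true), (1, false), (0, false), (0, false), (1, false)]) =
      moveClass (trivialLink 2) := by
  have h := generator_braid
  have ha := generator_pow_four 0
  have hb := generator_pow_four 1
  set a := generator 0
  set b := generator 1
  have e : a * b * a * a * b = b * b * (a * (b * b)⁻¹) :=
    calc a * b * a * a * b = a * (b * a * a * b) := by group
      _ = a⁻¹ * fullTwist a b * (b * b) * (b * b)⁻¹ := by
        rw [mul_sq_mul_eq h ha, ← inv_sq_eq ha]; group
      _ = _ := by rw [← sq_mul_eq h hb]; group
  calc moveClass (closure 3 [(0, true), (1, false), (0, false), (0, false), (1, false)]) =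
      quotientClosureClass (a * b * a * a * b) :=
        (moveClass_eq (closureWord_flip [true])).symm
    _ = quotientClosureClass a := by
      rw [e, quotientClosureClass_mul_comm, inv_mul_cancel_right]
    _ = _ := moveClass_three_single true

/-- The flip turns $z^{-1}$ into $z$. -/
theorem moveClass_fullTwist_inv :
    moveClass (closure 3 [(0, true), (0, true), (1, false), (0, false), (0, false), (1, false)]) =
      moveClass torusLink33 := by
  have h := (fullTwist_eq generator_braid).symm.trans (fullTwist_eq_pow generator_braid)
  exact (moveClass_eq (closureWord_flip [true, true])).symm.trans (congrArg quotientClosureClass h)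

/-- The trefoil word $baba = b^2ab$ is conjugate to $ab^3 = ab^{-1}$, which closes to the trivial
knot. -/
theorem moveClass_figureEight :
    moveClass (closure 3 [(1, false), (0, true), (1, false), (0, true)]) = moveClass unknot := by
  have h := generator_braid
  have hb := generator_pow_four 1
  set a := generator 0
  set b := generator 1
  have e : b * a * b * a = b * b * (a * b) :=
    calc b * a * b * a = b * (a * b * a) := by group
      _ = _ := by rw [h]; group
  calc moveClass (closure 3 [(1, false), (0, true), (1, false), (0, true)]) =
      quotientClosureClass (b * a * b * a) := moveClass_eq closureWord_figureEight
    _ = quotientClosureClass (a * b⁻¹) := by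
      rw [e, quotientClosureClass_mul_comm, ← inv_sq_eq hb]
      group
    _ = _ := moveClass_unknot true false

theorem isBasicClass_quotientClosureClass (x : FreeGroup (Fin 2) ⧸ trivialBraids) :
    IsBasicClass (quotientClosureClass x) := by
  refine forall_of_conj_invariant generator_braid (generator_pow_four 0) (generator_pow_four 1)
    closure_generator (fun x => IsBasicClass (quotientClosureClass x))
    (fun x y h => by rwa [quotientClosureClass_mul_comm])
    (.inr (.inr (.inr (.inl moveClass_three_nil))))
    (.inr (.inr (.inr (.inr (.inr (.inr (.inl rfl)))))))
    (.inr (.inr (.inr (.inr (.inr (.inr (.inl moveClass_fullTwist_inv)))))))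
    (.inr (.inr (.inr (.inr (.inr (.inr (.inr rfl)))))))
    (.inr (.inl (moveClass_three_single true)))
    (.inr (.inl (moveClass_three_single false)))
    (.inr (.inl moveClass_inv_flip))
    (.inr (.inl moveClass_flip))
    (.inr (.inr (.inr (.inr (.inl moveClass_three_double)))))
    (.inr (.inr (.inr (.inr (.inr (.inl (moveClass_eq closureWord_hopfSum)))))))
    (.inr (.inr (.inl (moveClass_hopf true))))
    (.inr (.inr (.inl (moveClass_hopf false))))
    (.inl (moveClass_unknot true true))
    (.inl (moveClass_unknot false false))
    (.inl (moveClass_unknot false true))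
    (.inl moveClass_figureEight) x

/-- Every closed braid on three strands is `4`-move equivalent to one of the basic links. -/
theorem isBasicClass_of_isClosedBraid {L : LinkDiagram} (hL : L.IsClosedBraid 3) :
    IsBasicClass (moveClass L) := by
  obtain ⟨β, hβ⟩ := hL
  have h : moveClass L = moveClass (closure 3 β) :=
    Quotient.sound <| show MoveEquiv 4 L (closure 3 β) from
      Relation.EqvGen.mono (fun _ _ h => Or.inl h) _ _ hβ
  rw [h]
  exact isBasicClass_quotientClosureClass (QuotientGroup.mk (FreeGroup.mk β))

theorem moveEquiv_cases {L : LinkDiagram} (hL : L.IsClosedBraid 3) :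
    MoveEquiv 4 L unknot ∨ MoveEquiv 4 L (trivialLink 2) ∨ MoveEquiv 4 L hopfLink ∨
    MoveEquiv 4 L (trivialLink 3) ∨ MoveEquiv 4 L (splitUnion hopfLink unknot) ∨
    MoveEquiv 4 L hopfSum ∨ MoveEquiv 4 L torusLink33 ∨ MoveEquiv 4 L borromeanRings := by
  have h {L' : LinkDiagram} (h : moveClass L = moveClass L') : MoveEquiv 4 L L' := Quotient.exact h
  exact (isBasicClass_of_isClosedBraid hL).imp h (.imp h (.imp h (.imp h (.imp h (.imp h
    (.imp h h))))))

end LinkDiagram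

theorem theorem1p14 :
    (∀ L : LinkDiagram, L.IsClosedBraid 3 → L.numComponents = 1 →
      LinkDiagram.MoveEquiv 4 L LinkDiagram.unknot) ∧
    (∀ L : LinkDiagram, L.IsClosedBraid 3 → L.numComponents = 2 →
      LinkDiagram.MoveEquiv 4 L (LinkDiagram.trivialLink 2) ∨
      LinkDiagram.MoveEquiv 4 L LinkDiagram.hopfLink) ∧
    (∀ L : LinkDiagram, L.IsClosedBraid 3 → L.numComponents = 3 →
      LinkDiagram.MoveEquiv 4 L (LinkDiagram.trivialLink 3) ∨
      LinkDiagram.MoveEquiv 4 L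
        (LinkDiagram.splitUnion LinkDiagram.hopfLink LinkDiagram.unknot) ∨
      LinkDiagram.MoveEquiv 4 L LinkDiagram.hopfSum ∨
      LinkDiagram.MoveEquiv 4 L LinkDiagram.torusLink33 ∨
      LinkDiagram.MoveEquiv 4 L LinkDiagram.borromeanRings) := by
  have h₁ {L : LinkDiagram} (h : L.MoveEquiv 4 LinkDiagram.unknot) :=
    LinkDiagram.numComponents_eq_of_moveEquiv h LinkDiagram.numColourings_unknot
  have h₂ {L : LinkDiagram} (h : L.MoveEquiv 4 (LinkDiagram.trivialLink 2)) :=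
    LinkDiagram.numComponents_eq_of_moveEquiv h LinkDiagram.numColourings_trivialLink_two
  have h₃ {L : LinkDiagram} (h : L.MoveEquiv 4 LinkDiagram.hopfLink) :=
    LinkDiagram.numComponents_eq_of_moveEquiv h LinkDiagram.numColourings_hopfLink
  have h₄ {L : LinkDiagram} (h : L.MoveEquiv 4 (LinkDiagram.trivialLink 3)) :=
    LinkDiagram.numComponents_eq_of_moveEquiv h LinkDiagram.numColourings_trivialLink_three
  have h₅ {L : LinkDiagram}
      (h : L.MoveEquiv 4 (LinkDiagram.splitUnion LinkDiagram.hopfLink LinkDiagram.unknot)) :=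
    LinkDiagram.numComponents_eq_of_moveEquiv h LinkDiagram.numColourings_hopfLink_unknot
  have h₆ {L : LinkDiagram} (h : L.MoveEquiv 4 LinkDiagram.hopfSum) :=
    LinkDiagram.numComponents_eq_of_moveEquiv h LinkDiagram.numColourings_hopfSum
  have h₇ {L : LinkDiagram} (h : L.MoveEquiv 4 LinkDiagram.torusLink33) :=
    LinkDiagram.numComponents_eq_of_moveEquiv h LinkDiagram.numColourings_torusLink33
  have h₈ {L : LinkDiagram} (h : L.MoveEquiv 4 LinkDiagram.borromeanRings) :=
    LinkDiagram.numComponents_eq_of_moveEquiv h LinkDiagram.numColourings_borromeanRings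
  -- Each of the eight basic links is either among the allowed alternatives or has the wrong number
  -- of components.
  refine ⟨fun L hL hn => ?_, fun L hL hn => ?_, fun L hL hn => ?_⟩ <;>
    rcases LinkDiagram.moveEquiv_cases hL with h | h | h | h | h | h | h | h <;>
    first
    | exact h
    | exact .inl h
    | exact .inr h
    | exact .inr (.inl h)
    | exact .inr (.inr (.inl h))
    | exact .inr (.inr (.inr (.inl h)))
    | exact .inr (.inr (.inr (.inr h)))
    | (exfalso
       first
       | (have := h₁ h; omega)
       | (have := h₂ h; omega)
       | (have := h₃ h; omega)
       | (have := h₄ h; omega)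
       | (have := h₅ h; omega)
       | (have := h₆ h; omega)
       | (have := h₇ h; omega)
       | (have := h₈ h; omega))
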